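/- Let $K$ be a field with an automorphism $\theta$ of finite order $r$, and let $F = K^{\theta}$. Let $\mathcal A = K[X^{\pm 1};\theta]$ be the ring of skew Laurent polynomials ($Xa = \theta(a)X$ for $a\in K$) and put $Y = X^r$, so that $F[Y]$ is central in $\mathcal A$. Let $\mathrm{Frac}(\mathcal A)$ be the skew field of fractions $g/D$ with $g \in \mathcal A$ and $0 \ne D \in F[Y]$. Fix a separable closure $F^{\mathrm s}$ of $F$. For $z \in F^{\mathrm s}$, $z\neq 0$, with minimal polynomial $N\in F[Y]$ over $F$, a morphism of $K$-algebras $\tau_z : \varprojlim_m \mathcal A/N^m\mathcal A \to (\mathcal A/N\mathcal A)[[T]]$ is called $z$-admissible if $\tau_z(X) \equiv X \pmod T$ and $\tau_z(Y) = z + T$, where $z$ is identified with the class of $Y$ in $\mathcal A/N\mathcal A$. It extends to $\mathrm{TS}_z : \mathrm{Frac}(\mathcal A) \to (\mathcal A/N\mathcal A)((T))$, $g/D \mapsto \tau_z(D)^{-1}\tau_z(g)$. The order $\mathrm{ord}_z(f)$ is the $T$-adic valuation of $\mathrm{TS}_z(f)$, and $f$ has at most a simple pole at $z$ if $\mathrm{ord}_z(f)\geq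 -1$. For $0\le j<r$, define the $j$-th partial skew residues of $f$ as follows. * For $z\in F^{\mathrm s}$, $z \neq 0$: $\mathrm{sres}_{z,j}(f) = \iota_z(\mathrm{sec}_j(s))\in K\otimes_F F^{\mathrm s}$, where $s \in \mathcal A/N\mathcal A$ is the coefficient of $T^{-1}$ in $\mathrm{TS}_z(f)$, $\mathrm{sec}_j:\mathcal A/N\mathcal A\to K[Y^{\pm1}]/(N)$ is induced by $\sum_i a_iX^i\mapsto\sum_i a_{j+ir}Y^i$, and $\iota_z$ maps $aY^i$ to $a\otimes z^i$. * $\mathrm{sres}_{0,j}(f)\in K$ is the coefficient of $X^{j-r}$ in the expansion of $f$ in $K((X;\theta))$. * $\mathrm{sres}_{\infty,j}(f)\in K$ is the opposite of the coefficient of $\tilde X^{r-j}$ in the expansion of $f$ in $K((\tilde X;\theta^{-1}))$, where $\tilde X=X^{-1}$. The last two are viewed in $K\otimes_F F^{\mathrm s}$ through $a\mapsto a\otimes 1$. Then a $z$-admissible morphism exists for every nonzero $z\in F^{\mathrm s}$. Moreover, let $\tau_z$ be any choice of $z$-admissible morphisms for all these $z$. Let $f\in\mathrm{Frac}(\mathcal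 A)$ be such that all its poles lie in $F^{\mathrm s}\cup\{\infty\}$, i.e. $f = g/D$ for some $g\in\mathcal A$ and some nonzero $D\in F[Y]$ that splits into linear factors over $F^{\mathrm s}$ (this is automatic if $F$ is perfect). Assume that $f$ has at most a simple pole at every nonzero $z\in F^{\mathrm s}$. Then for every $j\in\{0,\dots,r-1\}$ only finitely many $\mathrm{sres}_{z,j}(f)$ are nonzero and $$\sum_{z\in F^{\mathrm s}\sqcup\{\infty\}}\mathrm{sres}_{z,j}(f)=0 .$$ -/

import Mathlib

open Polynomial

noncomputable section

namespace SkewResidue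

universe u v

section Basic

variable {K : Type u} [Field K]

/-- The subfield `F` of `K` fixed by `θ`. -/
abbrev FixedField (θ : RingAut K) : Subfield K :=
  RingHom.eqLocusField (θ : K →+* K) (RingHom.id K)

/-- The action of `ℤ` (written multiplicatively) on `K` through the powers of `θ`. -/
abbrev zAction (θ : RingAut K) : MulSemiringAction (Multiplicative ℤ) K :=
  MulSemiringAction.compHom K (zpowersHom (RingAut K) θ)

/-- The ring `𝒜 = K[X^{±1}; θ]` of skew Laurent polynomials: `a X^i * b X^j = a θ^i(b) X^(i+j)`. -/
def SkewLaurent (_θ : RingAut K) : Type u := SkewMonoidAlgebra K (Multiplicative ℤ)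

instance (θ : RingAut K) : Ring (SkewLaurent θ) :=
  letI := zAction θ
  inferInstanceAs (Ring (SkewMonoidAlgebra K (Multiplicative ℤ)))

namespace SkewLaurent

variable (θ : RingAut K)

/-- The monomial `a X^n`. -/
def monomial (n : ℤ) (a : K) : SkewLaurent θ :=
  SkewMonoidAlgebra.single (Multiplicative.ofAdd n) a

variable {θ} in
/-- The coefficient of `X^n`, as a function of `n`. -/
def coeff (f : SkewLaurent θ) : ℤ →₀ K :=
  Finsupp.comapDomain Multiplicative.ofAdd (SkewMonoidAlgebra.coeff f)
    Multiplicative.ofAdd.injective.injOn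

theorem monomial_mul_monomial (i j : ℤ) (a b : K) :
    monomial θ i a * monomial θ j b = monomial θ (i + j) (a * (θ ^ i) b) := by
  let _ := zAction θ
  exact SkewMonoidAlgebra.single_mul_single

theorem coeff_monomial (n : ℤ) (a : K) : coeff (monomial θ n a) = Finsupp.single n a := by
  classical
  ext m
  simp [coeff, monomial, Finsupp.single_apply]

theorem coeff_add (f g : SkewLaurent θ) : coeff (f + g) = coeff f + coeff g := by
  ext m
  exact DFunLike.congr_fun (SkewMonoidAlgebra.coeff_add f g) _

theorem coeff_zero : coeff (0 : SkewLaurent θ) = 0 := by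
  ext m; rfl

variable {θ} in
theorem ext_coeff {f g : SkewLaurent θ} (h : ∀ n, coeff f n = coeff g n) : f = g :=
  SkewMonoidAlgebra.ext fun a => h a.toAdd

variable {θ} in
@[elab_as_elim]
theorem induction_on {p : SkewLaurent θ → Prop} (f : SkewLaurent θ) (h0 : p 0)
    (hm : ∀ n a, p (monomial θ n a)) (ha : ∀ f g, p f → p g → p (f + g)) : p f :=
  SkewMonoidAlgebra.induction_on f h0 (fun g a => hm g.toAdd a) ha

theorem monomial_add (n : ℤ) (a b : K) :
    monomial θ n (a + b) = monomial θ n a + monomial θ n b :=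
  SkewMonoidAlgebra.single_add _ _ _

theorem one_def : (1 : SkewLaurent θ) = monomial θ 0 1 := rfl

/-- The inclusion `K → 𝒜`. -/
def C : K →+* SkewLaurent θ where
  toFun := monomial θ 0
  map_one' := rfl
  map_zero' := SkewMonoidAlgebra.single_zero _
  map_add' := monomial_add θ 0
  map_mul' a b := by simp [monomial_mul_monomial]

/-- The variable `X`. -/
def X : SkewLaurent θ := monomial θ 1 1

/-- The central element `Y = X ^ r`, where `r` is the order of `θ`. -/
def Y : SkewLaurent θ := X θ ^ orderOf θ

theorem X_pow (n : ℕ) : X θ ^ n = monomial θ n 1 := by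
  induction n with
  | zero => rfl
  | succ n ih => rw [pow_succ, ih]; simp [X, monomial_mul_monomial]

theorem Y_eq : Y θ = monomial θ (orderOf θ) 1 := X_pow θ _

theorem fixed_zpow (c : FixedField θ) (n : ℤ) : (θ ^ n) (c : K) = c := by
  have h : θ ∈ MulAction.stabilizer (RingAut K) (c : K) := c.2
  exact (MulAction.stabilizer (RingAut K) (c : K)).zpow_mem h n

theorem C_fixed_comm (c : FixedField θ) (f : SkewLaurent θ) : Commute (C θ c) f := by
  induction f using induction_on with
  | h0 => exact Commute.zero_right _
  | hm n a =>
    change monomial θ 0 (c : K) * monomial θ n a = monomial θ n a * monomial θ 0 (c : K)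
    simp [monomial_mul_monomial, fixed_zpow, mul_comm]
  | ha f g hf hg => exact hf.add_right hg

theorem Y_comm (f : SkewLaurent θ) : Commute (Y θ) f := by
  induction f using induction_on with
  | h0 => exact Commute.zero_right _
  | hm n a =>
    rw [Y_eq]
    change monomial θ _ _ * monomial θ n a = monomial θ n a * monomial θ _ _
    simp [monomial_mul_monomial, add_comm]
  | ha f g hf hg => exact hf.add_right hg

/-- The inclusion `𝒵⁺ = F[Y] → 𝒜`, mapping the variable to `Y = X ^ r`. -/
def ofCentral : (FixedField θ)[X] →+* SkewLaurent θ :=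
  Polynomial.eval₂RingHom' ((C θ).comp (FixedField θ).subtype) (Y θ)
    fun c => C_fixed_comm θ c _

theorem ofCentral_X : ofCentral θ Polynomial.X = Y θ :=
  Polynomial.eval₂_X _ _

theorem ofCentral_C (c : FixedField θ) : ofCentral θ (Polynomial.C c) = C θ c :=
  Polynomial.eval₂_C _ _

theorem ofCentral_comm (D : (FixedField θ)[X]) (f : SkewLaurent θ) :
    Commute (ofCentral θ D) f := by
  induction D using Polynomial.induction_on' with
  | add p q hp hq => rw [map_add]; exact hp.add_left hq
  | monomial n c =>
    rw [← Polynomial.C_mul_X_pow_eq_monomial, map_mul, map_pow, ofCentral_X, ofCentral_C]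
    exact (C_fixed_comm θ c f).mul_left ((Y_comm θ f).pow_left n)

instance : Algebra (FixedField θ)[X] (SkewLaurent θ) :=
  (ofCentral θ).toAlgebra' fun D f => ofCentral_comm θ D f

theorem algebraMap_def : algebraMap (FixedField θ)[X] (SkewLaurent θ) = ofCentral θ := rfl

theorem Y_pow (n : ℕ) : Y θ ^ n = monomial θ (orderOf θ * n : ℕ) 1 := by
  rw [Y, ← pow_mul, X_pow]

theorem ofCentral_monomial (n : ℕ) (c : FixedField θ) :
    ofCentral θ (Polynomial.monomial n c) = monomial θ (orderOf θ * n : ℕ) c := by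
  rw [← Polynomial.C_mul_X_pow_eq_monomial, map_mul, map_pow, ofCentral_X, ofCentral_C, Y_pow]
  change monomial θ 0 _ * _ = _
  simp [monomial_mul_monomial]

end SkewLaurent

/-- The field `Frac(𝒜) = Frac(𝒵) ⊗ 𝒜` of skew rational functions: fractions `g / D` with
`g ∈ 𝒜` and `D` a nonzero element of `𝒵⁺ = F[Y]`. -/
abbrev SkewFrac (θ : RingAut K) : Type u :=
  LocalizedModule (nonZeroDivisors (FixedField θ)[X]) (SkewLaurent θ)

theorem units_fraction_eq {B : Type*} [Ring B] {x y : B} (hx : IsUnit x) (hy : IsUnit y)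
    (hxy : Commute x y) {a b : B} (h : y * a = x * b) :
    (↑hx.unit⁻¹ : B) * a = (↑hy.unit⁻¹ : B) * b := by
  have hpq : Commute hx.unit hy.unit := Units.ext hxy
  rw [Units.inv_mul_eq_iff_eq_mul,
    ← mul_assoc, ← Units.val_mul, hpq.inv_right.eq, Units.val_mul, mul_assoc,
    IsUnit.unit_spec, ← h, ← mul_assoc, IsUnit.val_inv_mul, one_mul]

/-- The extension of a ring homomorphism `φ : 𝒜 → B` to `Frac(𝒜)`, `g / D ↦ φ(D)⁻¹ φ(g)`,
when `φ` maps the nonzero elements of `𝒵⁺` to units. -/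
def fracLift {θ : RingAut K} {B : Type*} [Ring B] (φ : SkewLaurent θ →+* B)
    (hφ : ∀ D : (FixedField θ)[X], D ≠ 0 → IsUnit (φ (SkewLaurent.ofCentral θ D)))
    (f : SkewFrac θ) : B :=
  LocalizedModule.liftOn f
    (fun p => (↑(hφ p.2 (nonZeroDivisors.coe_ne_zero p.2)).unit⁻¹ : B) * φ p.1) (by
      rintro ⟨a, s⟩ ⟨b, t⟩ ⟨w, h⟩
      have hw := hφ w (nonZeroDivisors.coe_ne_zero w)
      simp only [Submonoid.smul_def, Algebra.smul_def, SkewLaurent.algebraMap_def] at h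
      have h2 := congrArg φ h
      simp only [map_mul] at h2
      exact units_fraction_eq _ _ ((SkewLaurent.ofCentral_comm θ s _).map φ)
        (hw.mul_left_cancel h2))

theorem fracLift_mk {θ : RingAut K} {B : Type*} [Ring B] (φ : SkewLaurent θ →+* B)
    (hφ : ∀ D : (FixedField θ)[X], D ≠ 0 → IsUnit (φ (SkewLaurent.ofCentral θ D)))
    (g : SkewLaurent θ) (D : nonZeroDivisors (FixedField θ)[X]) :
    fracLift φ hφ (LocalizedModule.mk g D) =
      (↑(hφ D (nonZeroDivisors.coe_ne_zero D)).unit⁻¹ : B) * φ g :=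
  rfl

/-- The ring `K((X; θ))` of skew Laurent series `∑ a_i X^i`, with the same multiplication rule
`a X^i * b X^j = a θ^i(b) X^(i+j)` as in `𝒜`. -/
def SkewSeries (_θ : RingAut K) : Type u := HahnSeries ℤ K

namespace SkewSeries

variable (θ : RingAut K)

instance : AddCommGroup (SkewSeries θ) := inferInstanceAs (AddCommGroup (HahnSeries ℤ K))

variable {θ} in
/-- The coefficient of `X^n`. -/
def coeff (f : SkewSeries θ) (n : ℤ) : K := HahnSeries.coeff f n

/-- The monomial `a X^n`. -/
def monomial (n : ℤ) (a : K) : SkewSeries θ := HahnSeries.single n a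

variable {θ} in
/-- The underlying Hahn series of a skew Laurent series. -/
def toHahn (f : SkewSeries θ) : HahnSeries ℤ K := f

/-- The skew Laurent series with a given underlying Hahn series. -/
def ofHahn (f : HahnSeries ℤ K) : SkewSeries θ := f

variable {θ} in
theorem isPWO (f : SkewSeries θ) : (Function.support f.coeff).IsPWO := HahnSeries.isPWO_support' f

variable {θ} in
theorem ext_coeff {f g : SkewSeries θ} (h : ∀ n, f.coeff n = g.coeff n) : f = g :=
  HahnSeries.ext (funext h)

instance : Mul (SkewSeries θ) where
  mul f g :=
    { coeff := fun n => ∑ ij ∈ Finset.antidiagonal f.isPWO g.isPWO n,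
        f.coeff ij.1 * (θ ^ ij.1) (g.coeff ij.2)
      isPWO_support' := by
        refine (f.isPWO.add g.isPWO).mono fun n hn => ?_
        obtain ⟨ij, hij, -⟩ := Finset.exists_ne_zero_of_sum_ne_zero hn
        rw [Finset.mem_antidiagonal] at hij
        exact ⟨_, hij.1, _, hij.2.1, hij.2.2⟩ }

instance : One (SkewSeries θ) := ⟨monomial θ 0 1⟩

theorem coeff_mul (f g : SkewSeries θ) (n : ℤ) :
    (f * g).coeff n = ∑ ij ∈ Finset.antidiagonal f.isPWO g.isPWO n,
      f.coeff ij.1 * (θ ^ ij.1) (g.coeff ij.2) := rfl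

/-- The embedding `∑ a_i X^i ↦ ∑ (a_i X^i) T^i` of `K((X; θ))` into `𝒜((T))`, used only to
transport the ring axioms. -/
def toLaurent (f : SkewSeries θ) : HahnSeries ℤ (SkewLaurent θ) where
  coeff n := SkewLaurent.monomial θ n (f.coeff n)
  isPWO_support' := f.isPWO.mono fun n hn h0 => hn (by
    simp only [h0]; exact SkewMonoidAlgebra.single_zero _)

theorem monomial_inj {n : ℤ} {a b : K}
    (h : SkewLaurent.monomial θ n a = SkewLaurent.monomial θ n b) : a = b :=
  SkewMonoidAlgebra.single_injective _ h

theorem monomial_eq_zero {n : ℤ} {a : K} : SkewLaurent.monomial θ n a = 0 ↔ a = 0 :=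
  SkewMonoidAlgebra.single_eq_zero

theorem toLaurent_injective : Function.Injective (toLaurent θ) := fun _ _ h =>
  ext_coeff fun n => monomial_inj θ (congrFun (congrArg HahnSeries.coeff h) n)

theorem monomial_sum {ι : Type*} (s : Finset ι) (n : ℤ) (a : ι → K) :
    SkewLaurent.monomial θ n (∑ i ∈ s, a i) = ∑ i ∈ s, SkewLaurent.monomial θ n (a i) :=
  map_sum (AddMonoidHom.mk' (SkewLaurent.monomial θ n) (SkewLaurent.monomial_add θ n)) a s

theorem toLaurent_mul (f g : SkewSeries θ) :
    toLaurent θ (f * g) = toLaurent θ f * toLaurent θ g := by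
  have hs : ∀ f : SkewSeries θ, (toLaurent θ f).support = Function.support f.coeff := fun f => by
    ext n
    exact not_congr (monomial_eq_zero θ)
  ext n
  rw [HahnSeries.coeff_mul]
  change SkewLaurent.monomial θ n ((f * g).coeff n) = _
  rw [coeff_mul, monomial_sum]
  refine Finset.sum_congr ?_ fun ij hij => ?_
  · ext ij
    simp [Finset.mem_antidiagonal, hs]
  · rw [Finset.mem_antidiagonal] at hij
    change _ = SkewLaurent.monomial θ _ _ * SkewLaurent.monomial θ _ _
    rw [SkewLaurent.monomial_mul_monomial, hij.2.2]

theorem toLaurent_add (f g : SkewSeries θ) :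
    toLaurent θ (f + g) = toLaurent θ f + toLaurent θ g := by
  ext n
  exact SkewLaurent.monomial_add θ n _ _

theorem toLaurent_zero : toLaurent θ 0 = 0 := by
  ext n
  exact SkewMonoidAlgebra.single_zero _

theorem toLaurent_one : toLaurent θ 1 = 1 := by
  ext n
  change SkewLaurent.monomial θ n ((HahnSeries.single (0 : ℤ) (1 : K)).coeff n) = _
  rw [HahnSeries.coeff_one, HahnSeries.coeff_single]
  split_ifs with h
  · rw [h]; rfl
  · exact SkewMonoidAlgebra.single_zero _

instance : Ring (SkewSeries θ) where
  __ := (inferInstance : AddCommGroup (SkewSeries θ))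
  __ := (inferInstance : Mul (SkewSeries θ))
  __ := (inferInstance : One (SkewSeries θ))
  mul_assoc a b c := toLaurent_injective θ (by simp only [toLaurent_mul, mul_assoc])
  one_mul a := toLaurent_injective θ (by simp only [toLaurent_mul, toLaurent_one, one_mul])
  mul_one a := toLaurent_injective θ (by simp only [toLaurent_mul, toLaurent_one, mul_one])
  left_distrib a b c := toLaurent_injective θ (by
    simp only [toLaurent_mul, toLaurent_add, mul_add])
  right_distrib a b c := toLaurent_injective θ (by
    simp only [toLaurent_mul, toLaurent_add, add_mul])
  zero_mul a := toLaurent_injective θ (by simp only [toLaurent_mul, toLaurent_zero, zero_mul])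
  mul_zero a := toLaurent_injective θ (by simp only [toLaurent_mul, toLaurent_zero, mul_zero])

theorem monomial_mul_monomial (i j : ℤ) (a b : K) :
    monomial θ i a * monomial θ j b = monomial θ (i + j) (a * (θ ^ i) b) := by
  have hm : ∀ i a, toLaurent θ (monomial θ i a) =
      HahnSeries.single i (SkewLaurent.monomial θ i a) := fun i a => by
    ext n
    change SkewLaurent.monomial θ n ((HahnSeries.single i a).coeff n) = _
    rw [HahnSeries.coeff_single, HahnSeries.coeff_single]
    split_ifs with h
    · rw [h]
    · exact SkewMonoidAlgebra.single_zero _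
  apply toLaurent_injective θ
  rw [toLaurent_mul, hm, hm, hm, HahnSeries.single_mul_single, SkewLaurent.monomial_mul_monomial]

/-- The inclusion `K → K((X; θ))`. -/
def C : K →+* SkewSeries θ where
  toFun := monomial θ 0
  map_one' := rfl
  map_zero' := HahnSeries.single_eq_zero
  map_add' := HahnSeries.single_add 0
  map_mul' a b := by simp [monomial_mul_monomial]

/-- The invertible element `X ^ n` of `K((X; θ))`. -/
def Xpow : Multiplicative ℤ →* SkewSeries θ where
  toFun n := monomial θ n.toAdd 1
  map_one' := rfl
  map_mul' m n := by simp [monomial_mul_monomial]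

end SkewSeries

/-- The morphism of `K`-algebras `𝒜 = K[X^{±1}; θ] → K((X; θ))` mapping `X` to `X`. -/
def expandZero (θ : RingAut K) : SkewLaurent θ →+* SkewSeries θ :=
  letI := zAction θ
  SkewMonoidAlgebra.liftNCRingHom (SkewSeries.C θ) (SkewSeries.Xpow θ) (by
    intro x y
    change SkewSeries.monomial θ 0 ((θ ^ y.toAdd) x) * SkewSeries.monomial θ y.toAdd 1 =
      SkewSeries.monomial θ y.toAdd 1 * SkewSeries.monomial θ 0 x
    simp [SkewSeries.monomial_mul_monomial])

/-- The morphism of `K`-algebras `𝒜 = K[X^{±1}; θ] → K((X̃; θ⁻¹))` mapping `X` to `X̃⁻¹`. -/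
def expandInfty (θ : RingAut K) : SkewLaurent θ →+* SkewSeries θ⁻¹ :=
  letI := zAction θ
  SkewMonoidAlgebra.liftNCRingHom (SkewSeries.C θ⁻¹)
    ((SkewSeries.Xpow θ⁻¹).comp (zpowersHom (Multiplicative ℤ) (Multiplicative.ofAdd (-1)))) (by
    intro x y
    change SkewSeries.monomial θ⁻¹ 0 ((θ ^ y.toAdd) x) * SkewSeries.monomial θ⁻¹ _ 1 =
      SkewSeries.monomial θ⁻¹ _ 1 * SkewSeries.monomial θ⁻¹ 0 x
    simp [SkewSeries.monomial_mul_monomial])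

theorem expandZero_monomial (θ : RingAut K) (n : ℤ) (a : K) :
    expandZero θ (SkewLaurent.monomial θ n a) = SkewSeries.monomial θ n a := by
  let _ := zAction θ
  refine (SkewMonoidAlgebra.liftNC_single _ _ _ _).trans ?_
  change SkewSeries.monomial θ 0 a * SkewSeries.monomial θ n 1 = _
  simp [SkewSeries.monomial_mul_monomial]

theorem expandInfty_monomial (θ : RingAut K) (n : ℤ) (a : K) :
    expandInfty θ (SkewLaurent.monomial θ n a) = SkewSeries.monomial θ⁻¹ (-n) a := by
  let _ := zAction θ
  refine (SkewMonoidAlgebra.liftNC_single _ _ _ _).trans ?_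
  change SkewSeries.monomial θ⁻¹ 0 a * SkewSeries.monomial θ⁻¹ _ 1 = _
  simp [SkewSeries.monomial_mul_monomial]

theorem coeff_expandZero {θ : RingAut K} (f : SkewLaurent θ) (n : ℤ) :
    (expandZero θ f).coeff n = f.coeff n := by
  classical
  induction f using SkewLaurent.induction_on with
  | h0 => rw [map_zero, SkewLaurent.coeff_zero]; rfl
  | hm m a =>
    rw [expandZero_monomial, SkewLaurent.coeff_monomial, Finsupp.single_apply]
    simp only [SkewSeries.coeff, SkewSeries.monomial, HahnSeries.coeff_single]
    split_ifs <;> grind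
  | ha f g hf hg =>
    rw [map_add, SkewLaurent.coeff_add, Finsupp.add_apply, ← hf, ← hg]
    rfl

theorem coeff_expandInfty {θ : RingAut K} (f : SkewLaurent θ) (n : ℤ) :
    (expandInfty θ f).coeff n = f.coeff (-n) := by
  classical
  induction f using SkewLaurent.induction_on with
  | h0 => rw [map_zero, SkewLaurent.coeff_zero]; rfl
  | hm m a =>
    rw [expandInfty_monomial, SkewLaurent.coeff_monomial, Finsupp.single_apply]
    simp only [SkewSeries.coeff, SkewSeries.monomial, HahnSeries.coeff_single]
    split_ifs <;> grind
  | ha f g hf hg =>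
    rw [map_add, SkewLaurent.coeff_add, Finsupp.add_apply, ← hf, ← hg]
    rfl

theorem coeff_ofCentral_mem (θ : RingAut K) (D : (FixedField θ)[X]) (m : ℤ) :
    (SkewLaurent.ofCentral θ D).coeff m ∈ FixedField θ := by
  classical
  induction D using Polynomial.induction_on' with
  | add p q hp hq =>
    rw [map_add, SkewLaurent.coeff_add]
    exact add_mem hp hq
  | monomial n c =>
    rw [SkewLaurent.ofCentral_monomial, SkewLaurent.coeff_monomial, Finsupp.single_apply]
    split_ifs
    exacts [c.2, zero_mem _]

theorem coeff_ofCentral_of_not_dvd (θ : RingAut K) (D : (FixedField θ)[X]) {m : ℤ}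
    (hm : ¬ (orderOf θ : ℤ) ∣ m) : (SkewLaurent.ofCentral θ D).coeff m = 0 := by
  classical
  induction D using Polynomial.induction_on' with
  | add p q hp hq =>
    rw [map_add, SkewLaurent.coeff_add, Finsupp.add_apply, hp, hq, add_zero]
  | monomial n c =>
    rw [SkewLaurent.ofCentral_monomial, SkewLaurent.coeff_monomial, Finsupp.single_apply,
      if_neg]
    rintro rfl
    exact hm (by simp)

theorem coeff_ofCentral_mul {θ : RingAut K} (hθ : IsOfFinOrder θ) (D : (FixedField θ)[X]) (n : ℕ) :
    (SkewLaurent.ofCentral θ D).coeff (orderOf θ * n : ℕ) = D.coeff n := by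
  classical
  induction D using Polynomial.induction_on' with
  | add p q hp hq =>
    rw [map_add, SkewLaurent.coeff_add, Finsupp.add_apply, hp, hq]
    simp
  | monomial m c =>
    rw [SkewLaurent.ofCentral_monomial, SkewLaurent.coeff_monomial, Finsupp.single_apply,
      Polynomial.coeff_monomial]
    have h : ((orderOf θ * m : ℕ) : ℤ) = (orderOf θ * n : ℕ) ↔ m = n := by
      rw [Nat.cast_inj]
      exact Nat.mul_right_inj hθ.orderOf_pos.ne'
    simp only [h]
    split_ifs <;> rfl

theorem exists_coeff_ofCentral_ne_zero {θ : RingAut K} (hθ : IsOfFinOrder θ)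
    {D : (FixedField θ)[X]} (hD : D ≠ 0) : ∃ m, (SkewLaurent.ofCentral θ D).coeff m ≠ 0 := by
  obtain ⟨n, hn⟩ : ∃ n, D.coeff n ≠ 0 := by
    by_contra! h
    exact hD (Polynomial.ext h)
  refine ⟨(orderOf θ * n : ℕ), ?_⟩
  rw [coeff_ofCentral_mul hθ]
  simpa using hn

theorem SkewSeries.isUnit_of_central {θ : RingAut K} (d : SkewSeries θ) (h0 : ∃ n, d.coeff n ≠ 0)
    (h1 : ∀ i, d.coeff i ≠ 0 → θ ^ i = 1) (h2 : ∀ i j : ℤ, (θ ^ i) (d.coeff j) = d.coeff j) :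
    IsUnit d := by
  have hd : toHahn d ≠ 0 := by
    rintro h
    obtain ⟨n, hn⟩ := h0
    exact hn (congrFun (congrArg HahnSeries.coeff h) n)
  have hde : toHahn d * (toHahn d)⁻¹ = 1 := mul_inv_cancel₀ hd
  have hed : (toHahn d)⁻¹ * toHahn d = 1 := inv_mul_cancel₀ hd
  refine isUnit_iff_exists.2
    ⟨ofHahn θ (toHahn d)⁻¹, ext_coeff fun n => ?_, ext_coeff fun n => ?_⟩
  · refine Eq.trans ?_ (congrFun (congrArg HahnSeries.coeff hde) n)
    rw [coeff_mul, HahnSeries.coeff_mul]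
    refine Finset.sum_congr rfl fun ij hij => ?_
    rw [h1 _ (Finset.mem_antidiagonal.1 hij).1]
    rfl
  · refine Eq.trans ?_ (congrFun (congrArg HahnSeries.coeff hed) n)
    rw [coeff_mul, HahnSeries.coeff_mul]
    refine Finset.sum_congr rfl fun ij hij => ?_
    rw [h2]
    rfl

theorem isUnit_expandZero {θ : RingAut K} (hθ : IsOfFinOrder θ) (D : (FixedField θ)[X])
    (hD : D ≠ 0) : IsUnit (expandZero θ (SkewLaurent.ofCentral θ D)) := by
  apply SkewSeries.isUnit_of_central
  · simpa only [coeff_expandZero] using exists_coeff_ofCentral_ne_zero hθ hD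
  · intro i hi
    rw [coeff_expandZero] at hi
    refine orderOf_dvd_iff_zpow_eq_one.1 ?_
    by_contra h
    exact hi (coeff_ofCentral_of_not_dvd θ D h)
  · intro i j
    rw [coeff_expandZero]
    exact SkewLaurent.fixed_zpow θ ⟨_, coeff_ofCentral_mem θ D j⟩ i

theorem isUnit_expandInfty {θ : RingAut K} (hθ : IsOfFinOrder θ) (D : (FixedField θ)[X])
    (hD : D ≠ 0) : IsUnit (expandInfty θ (SkewLaurent.ofCentral θ D)) := by
  apply SkewSeries.isUnit_of_central
  · obtain ⟨m, hm⟩ := exists_coeff_ofCentral_ne_zero hθ hD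
    exact ⟨-m, by rwa [coeff_expandInfty, neg_neg]⟩
  · intro i hi
    rw [coeff_expandInfty] at hi
    rw [inv_zpow']
    refine orderOf_dvd_iff_zpow_eq_one.1 ?_
    by_contra h
    exact hi (coeff_ofCentral_of_not_dvd θ D h)
  · intro i j
    rw [coeff_expandInfty, inv_zpow']
    exact SkewLaurent.fixed_zpow θ ⟨_, coeff_ofCentral_mem θ D _⟩ _

/-- The Taylor expansion map `TS_0 : Frac(𝒜) → K((X; θ))`. -/
def taylorZero {θ : RingAut K} (hθ : IsOfFinOrder θ) : SkewFrac θ → SkewSeries θ :=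
  fracLift (expandZero θ) (isUnit_expandZero hθ)

/-- The Taylor expansion map `TS_∞ : Frac(𝒜) → K((X̃; θ⁻¹))`, where `X̃ = X⁻¹`. -/
def taylorInfty {θ : RingAut K} (hθ : IsOfFinOrder θ) : SkewFrac θ → SkewSeries θ⁻¹ :=
  fracLift (expandInfty θ) (isUnit_expandInfty hθ)

section Quotient

variable (θ : RingAut K)

/-- The ideal `N𝒜` of `𝒜`, for `N ∈ 𝒵⁺`. -/
abbrev centralIdeal (N : (FixedField θ)[X]) : Ideal (SkewLaurent θ) :=
  Ideal.span {SkewLaurent.ofCentral θ N}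

instance (N : (FixedField θ)[X]) : (centralIdeal θ N).IsTwoSided where
  mul_mem_of_left {a} b ha := by
    obtain ⟨c, rfl⟩ := Ideal.mem_span_singleton'.1 ha
    refine Ideal.mem_span_singleton'.2 ⟨c * b, ?_⟩
    rw [mul_assoc, mul_assoc, (SkewLaurent.ofCentral_comm θ N b).eq]

/-- The quotient ring `𝒜 / N𝒜`. -/
abbrev SkewQuot (N : (FixedField θ)[X]) : Type u := SkewLaurent θ ⧸ centralIdeal θ N

theorem centralIdeal_pow_le (N : (FixedField θ)[X]) {m n : ℕ} (h : m ≤ n) :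
    centralIdeal θ (N ^ n) ≤ centralIdeal θ (N ^ m) := by
  rw [Ideal.span_singleton_le_iff_mem, Ideal.mem_span_singleton']
  refine ⟨SkewLaurent.ofCentral θ (N ^ (n - m)), ?_⟩
  rw [← map_mul, ← pow_add, Nat.sub_add_cancel h]

/-- The completion `lim 𝒜 / N^m 𝒜`, as the ring of compatible families. -/
def completion (N : (FixedField θ)[X]) : Subring (∀ m : ℕ, SkewQuot θ (N ^ m)) where
  carrier := {f | ∀ m n (h : m ≤ n), Ideal.Quotient.factor (centralIdeal_pow_le θ N h) (f n) = f m}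
  mul_mem' hf hg m n h := by rw [Pi.mul_apply, map_mul, hf m n h, hg m n h]; rfl
  one_mem' m n h := map_one _
  add_mem' hf hg m n h := by rw [Pi.add_apply, map_add, hf m n h, hg m n h]; rfl
  zero_mem' m n h := map_zero _
  neg_mem' hf m n h := by rw [Pi.neg_apply, map_neg, hf m n h]; rfl

/-- The natural map `𝒜 → lim 𝒜 / N^m 𝒜`. -/
def toCompletion (N : (FixedField θ)[X]) : SkewLaurent θ →+* completion θ N :=
  RingHom.codRestrict (RingHom.pi fun m => Ideal.Quotient.mk (centralIdeal θ (N ^ m)))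
    (completion θ N) fun _ _ _ _ => rfl

end Quotient

section Admissible

variable (θ : RingAut K) {Fs : Type v} [Field Fs] [Algebra (FixedField θ) Fs]

/-- A `z`-admissible morphism: a morphism of `K`-algebras `τ : lim 𝒜 / N^m 𝒜 → (𝒜 / N𝒜)[[T]]`,
where `N` is the minimal polynomial of `z` over `F`, such that `τ(X) ≡ X (mod T)` and
`τ(Y) = z + T`. Here `z` is seen in `𝒜 / N𝒜` as the class of `Y`. -/
structure Admissible (z : Fs) where
  /-- The underlying ring homomorphism. -/
  toRingHom : completion θ (minpoly (FixedField θ) z) →+*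
    PowerSeries (SkewQuot θ (minpoly (FixedField θ) z))
  map_C : ∀ a : K, toRingHom (toCompletion θ _ (SkewLaurent.C θ a)) =
    PowerSeries.C (Ideal.Quotient.mk _ (SkewLaurent.C θ a))
  map_X : PowerSeries.constantCoeff (toRingHom (toCompletion θ _ (SkewLaurent.X θ))) =
    Ideal.Quotient.mk _ (SkewLaurent.X θ)
  map_Y : toRingHom (toCompletion θ _ (SkewLaurent.Y θ)) =
    PowerSeries.C (Ideal.Quotient.mk _ (SkewLaurent.Y θ)) + PowerSeries.X

namespace Admissible

variable {θ} {z : Fs} (τ : Admissible θ z)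

/-- The composite `𝒜 → lim 𝒜 / N^m 𝒜 → (𝒜 / N𝒜)[[T]] → (𝒜 / N𝒜)((T))`. -/
def expand : SkewLaurent θ →+* LaurentSeries (SkewQuot θ (minpoly (FixedField θ) z)) :=
  (HahnSeries.ofPowerSeries ℤ _).comp (τ.toRingHom.comp (toCompletion θ _))

theorem isUnit_expand (hz : IsIntegral (FixedField θ) z) (D : (FixedField θ)[X]) (hD : D ≠ 0) :
    IsUnit (τ.expand (SkewLaurent.ofCentral θ D)) := by
  have : Fact (Irreducible (minpoly (FixedField θ) z)) := ⟨minpoly.irreducible hz⟩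
  let L := AdjoinRoot (minpoly (FixedField θ) z)
  let ψ : L →+* SkewQuot θ (minpoly (FixedField θ) z) :=
    Ideal.Quotient.lift (Ideal.span {minpoly (FixedField θ) z})
      ((Ideal.Quotient.mk _).comp (SkewLaurent.ofCentral θ)) (by
        intro a ha
        obtain ⟨c, rfl⟩ := Ideal.mem_span_singleton'.1 ha
        rw [RingHom.comp_apply, map_mul, Ideal.Quotient.eq_zero_iff_mem]
        exact Ideal.mul_mem_left _ _ (Ideal.mem_span_singleton_self _))
  let t : (FixedField θ)[X] →+* PowerSeries L :=
    Polynomial.coeToPowerSeries.ringHom.comp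
      ((Polynomial.taylorAlgHom (AdjoinRoot.root (minpoly (FixedField θ) z))).toRingHom.comp
        (Polynomial.mapRingHom (AdjoinRoot.of (minpoly (FixedField θ) z))))
  have key : (τ.toRingHom.comp (toCompletion θ _)).comp (SkewLaurent.ofCentral θ) =
      (PowerSeries.map ψ).comp t := by
    refine Polynomial.ringHom_ext (fun a => ?_) ?_
    · have h1 : ψ (AdjoinRoot.of (minpoly (FixedField θ) z) a) =
          Ideal.Quotient.mk _ (SkewLaurent.ofCentral θ (Polynomial.C a)) := rfl
      simp only [RingHom.comp_apply, SkewLaurent.ofCentral_C, τ.map_C]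
      simp [t, h1, SkewLaurent.ofCentral_C]
    · have h1 : ψ (AdjoinRoot.root (minpoly (FixedField θ) z)) =
          Ideal.Quotient.mk _ (SkewLaurent.ofCentral θ Polynomial.X) := rfl
      simp only [RingHom.comp_apply, SkewLaurent.ofCentral_X, τ.map_Y]
      simp [t, h1, SkewLaurent.ofCentral_X, add_comm]
  have ht : t D ≠ 0 := by
    intro h
    have h2 : Polynomial.taylor (AdjoinRoot.root (minpoly (FixedField θ) z))
        (D.map (AdjoinRoot.of (minpoly (FixedField θ) z))) = 0 :=
      Polynomial.coe_injective _ (h.trans Polynomial.coe_zero.symm)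
    rw [Polynomial.taylor_eq_zero, Polynomial.map_eq_zero] at h2
    exact hD h2
  have hexp : τ.expand (SkewLaurent.ofCentral θ D) =
      HahnSeries.ofPowerSeries ℤ _ (PowerSeries.map ψ (t D)) :=
    congrArg (HahnSeries.ofPowerSeries ℤ _) (RingHom.congr_fun key D)
  rw [hexp, ← PowerSeries.X_pow_order_mul_divXPowOrder (f := t D), map_mul, map_mul, map_pow,
    PowerSeries.map_X, HahnSeries.ofPowerSeries_X_pow]
  refine IsUnit.mul ?_ ?_
  · refine isUnit_iff_exists.2 ⟨HahnSeries.single (-((t D).order.toNat : ℤ)) 1, ?_, ?_⟩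
    · simp [HahnSeries.single_mul_single]
    · simp [HahnSeries.single_mul_single]
  · exact ((PowerSeries.isUnit_divided_by_X_pow_order ht).map _).map _

theorem isIntegral_of_isSepClosure [IsSepClosure (FixedField θ) Fs] (z : Fs) :
    IsIntegral (FixedField θ) z :=
  have : Algebra.IsSeparable (FixedField θ) Fs := IsSepClosure.separable
  Algebra.IsIntegral.isIntegral z

/-- The Taylor expansion map `TS_z : Frac(𝒜) → (𝒜 / N𝒜)((T))` attached to a `z`-admissible
morphism. -/
def taylor [IsSepClosure (FixedField θ) Fs] :
    SkewFrac θ → LaurentSeries (SkewQuot θ (minpoly (FixedField θ) z)) :=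
  fracLift τ.expand (τ.isUnit_expand (isIntegral_of_isSepClosure z))

/-- The order of vanishing `ord_z(f)`: the `T`-adic valuation of `TS_z(f)`. -/
def ord [IsSepClosure (FixedField θ) Fs] (f : SkewFrac θ) : WithTop ℤ :=
  (τ.taylor f).orderTop

/-- The skew residue `sres_z(f)`: the coefficient of `T⁻¹` in `TS_z(f)`. -/
def sres [IsSepClosure (FixedField θ) Fs] (f : SkewFrac θ) :
    SkewQuot θ (minpoly (FixedField θ) z) :=
  (τ.taylor f).coeff (-1)

end Admissible

end Admissible

section Sections

/-- The section operator `sec_j : 𝒜 → 𝒞 = K[Y^{±1}]`, `∑ a_i X^i ↦ ∑ a_{j+ir} Y^i`. -/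
def sec {θ : RingAut K} (hθ : IsOfFinOrder θ) (j : ℤ) : SkewLaurent θ →+ LaurentPolynomial K where
  toFun f := AddMonoidAlgebra.ofCoeff
    (Finsupp.comapDomain (fun i : ℤ => j + i * (orderOf θ : ℤ)) f.coeff (by
      intro a _ b _ h
      have := hθ.orderOf_pos
      simpa [this.ne'] using h))
  map_zero' := by ext i; rfl
  map_add' f g := by
    ext i
    exact DFunLike.congr_fun (SkewLaurent.coeff_add θ f g) _

theorem coeff_sec {θ : RingAut K} (hθ : IsOfFinOrder θ) (j : ℤ) (f : SkewLaurent θ) (i : ℤ) :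
    (sec hθ j f).coeff i = f.coeff (j + i * orderOf θ) := rfl

/-- The inclusion `𝒵⁺ = F[Y] → 𝒞 = K[Y^{±1}]`. -/
def centralToLaurent (θ : RingAut K) : (FixedField θ)[X] →+* LaurentPolynomial K :=
  Polynomial.toLaurent.comp (Polynomial.mapRingHom (FixedField θ).subtype)

/-- The quotient `𝒞 / N𝒞`, for `N ∈ 𝒵⁺`. -/
abbrev CommQuot (θ : RingAut K) (N : (FixedField θ)[X]) : Type u :=
  LaurentPolynomial K ⧸ Ideal.span {centralToLaurent θ N}

theorem sec_ofCentral_mul {θ : RingAut K} (hθ : IsOfFinOrder θ) (j : ℤ) (D : (FixedField θ)[X])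
    (f : SkewLaurent θ) :
    sec hθ j (SkewLaurent.ofCentral θ D * f) = centralToLaurent θ D * sec hθ j f := by
  classical
  induction D using Polynomial.induction_on' with
  | add p q hp hq => simp only [map_add, add_mul, hp, hq]
  | monomial m c =>
    induction f using SkewLaurent.induction_on with
    | h0 => simp
    | ha f g hf hg => simp only [map_add, mul_add, hf, hg]
    | hm n a =>
      ext i
      rw [SkewLaurent.ofCentral_monomial, SkewLaurent.monomial_mul_monomial, coeff_sec,
        SkewLaurent.coeff_monomial, centralToLaurent, RingHom.comp_apply,
        Polynomial.coe_mapRingHom, Polynomial.map_monomial, ← Polynomial.C_mul_X_pow_eq_monomial,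
        map_mul, map_pow, Polynomial.toLaurent_C, Polynomial.toLaurent_X, LaurentPolynomial.T_pow,
        ← LaurentPolynomial.single_eq_C_mul_T, AddMonoidAlgebra.coeff_single_mul_apply, coeff_sec,
        SkewLaurent.coeff_monomial, Finsupp.single_apply, Finsupp.single_apply]
      have h1 : θ ^ ((orderOf θ * m : ℕ) : ℤ) = 1 := by
        rw [zpow_natCast, pow_mul, pow_orderOf_eq_one, one_pow]
      rw [h1]
      have h2 : ((orderOf θ * m : ℕ) : ℤ) + n = j + i * orderOf θ ↔
          n = j + (-((m : ℤ) * 1) + i) * orderOf θ := by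
        push_cast
        constructor <;> intro h <;> linarith
      simp only [h2]
      split_ifs
      · rfl
      · simp

/-- The map `𝒜 / N𝒜 → 𝒞 / N𝒞` induced by the section operator `sec_j`. -/
def secQuot {θ : RingAut K} (hθ : IsOfFinOrder θ) (j : ℤ) (N : (FixedField θ)[X]) :
    SkewQuot θ N →+ CommQuot θ N :=
  QuotientAddGroup.lift (centralIdeal θ N).toAddSubgroup
    ((Ideal.Quotient.mk (Ideal.span {centralToLaurent θ N})).toAddMonoidHom.comp (sec hθ j)) (by
      intro f hf
      obtain ⟨g, rfl⟩ := Ideal.mem_span_singleton'.1 hf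
      rw [← (SkewLaurent.ofCentral_comm θ N g).eq]
      change Ideal.Quotient.mk _ (sec hθ j _) = 0
      rw [sec_ofCentral_mul, Ideal.Quotient.eq_zero_iff_mem]
      exact Ideal.mul_mem_right _ _ (Ideal.mem_span_singleton_self _))

open TensorProduct

variable (θ : RingAut K) {Fs : Type v} [Field Fs] [Algebra (FixedField θ) Fs]

/-- The embedding `ι_z : 𝒞 / N𝒞 → K ⊗_F Fˢ`, `a Y^i ↦ a ⊗ z^i`, where `N` is the minimal
polynomial of `z ≠ 0`. -/
def iota (z : Fs) (hz : z ≠ 0) :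
    CommQuot θ (minpoly (FixedField θ) z) →+* K ⊗[FixedField θ] Fs :=
  Ideal.Quotient.lift _
    (LaurentPolynomial.eval₂ (algebraMap K (K ⊗[FixedField θ] Fs))
      (Units.map (Algebra.TensorProduct.includeRight :
        Fs →ₐ[FixedField θ] K ⊗[FixedField θ] Fs).toRingHom.toMonoidHom (Units.mk0 z hz))) (by
      intro a ha
      obtain ⟨c, rfl⟩ := Ideal.mem_span_singleton'.1 ha
      rw [map_mul]
      refine mul_eq_zero_of_right _ ?_
      rw [centralToLaurent, RingHom.comp_apply, LaurentPolynomial.eval₂_toLaurent,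
        Polynomial.coe_mapRingHom, Polynomial.eval₂_map]
      have h : (algebraMap K (K ⊗[FixedField θ] Fs)).comp (FixedField θ).subtype =
          ((Algebra.TensorProduct.includeRight :
            Fs →ₐ[FixedField θ] K ⊗[FixedField θ] Fs).toRingHom).comp
              (algebraMap (FixedField θ) Fs) := by
        ext a
        exact ((Algebra.TensorProduct.includeRight :
          Fs →ₐ[FixedField θ] K ⊗[FixedField θ] Fs).commutes a).symm
      rw [h]
      have h3 := Polynomial.hom_eval₂ (minpoly (FixedField θ) z) (algebraMap (FixedField θ) Fs)
        ((Algebra.TensorProduct.includeRight :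
            Fs →ₐ[FixedField θ] K ⊗[FixedField θ] Fs).toRingHom) z
      refine h3.symm.trans ?_
      rw [← Polynomial.aeval_def, minpoly.aeval, map_zero])

variable {θ}

/-- The `j`-th partial skew residue of `f` at a nonzero point `z`: `ι_z (sec_j (sres_z f))`. -/
def Admissible.partialRes (hθ : IsOfFinOrder θ) [IsSepClosure (FixedField θ) Fs] {z : Fs}
    (τ : Admissible θ z) (hz : z ≠ 0) (j : ℕ) (f : SkewFrac θ) : K ⊗[FixedField θ] Fs :=
  iota θ z hz (secQuot hθ j _ (τ.sres f))

/-- The `j`-th partial skew residue of `f` at `0`: the coefficient of `X^(j-r)` in `TS_0(f)`. -/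
def partialResZero (hθ : IsOfFinOrder θ) (j : ℕ) (f : SkewFrac θ) : K :=
  (taylorZero hθ f).coeff ((j : ℤ) - orderOf θ)

/-- The `j`-th partial skew residue of `f` at `∞`: the opposite of the coefficient of `X̃^(r-j)`
in `TS_∞(f)`. -/
def partialResInfty (hθ : IsOfFinOrder θ) (j : ℕ) (f : SkewFrac θ) : K :=
  -(taylorInfty hθ f).coeff ((orderOf θ : ℤ) - j)

open Classical in
/-- The `j`-th partial skew residue of `f` at a point of `Fˢ ∪ {∞}`, with respect to a choice `τ`
of admissible morphisms at the nonzero points of `Fˢ`. The residues at `0` and `∞`, which belong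
to `K`, are seen in `K ⊗_F Fˢ`. -/
def partialRes (hθ : IsOfFinOrder θ) [IsSepClosure (FixedField θ) Fs]
    (τ : ∀ z : Fs, z ≠ 0 → Admissible θ z) (j : ℕ) (f : SkewFrac θ) (p : OnePoint Fs) :
    K ⊗[FixedField θ] Fs :=
  p.elim (algebraMap K (K ⊗[FixedField θ] Fs) (partialResInfty hθ j f)) fun z =>
    if hz : z = 0 then algebraMap K (K ⊗[FixedField θ] Fs) (partialResZero hθ j f)
    else (τ z hz).partialRes hθ hz j f

variable (Fs) in
/-- All the poles of `f` are in `Fˢ ∪ {∞}`: `f` can be written `g / D` with `g ∈ 𝒜` and with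
`D ∈ F[Y]` nonzero whose roots all belong to `Fˢ`. -/
def PolesSeparable (f : SkewFrac θ) : Prop :=
  ∃ (g : SkewLaurent θ) (D : nonZeroDivisors (FixedField θ)[X]),
    f = LocalizedModule.mk g D ∧
      ((D : (FixedField θ)[X]).map (algebraMap (FixedField θ) Fs)).Splits

end Sections

end Basic

end SkewResidue

end

/-! At a nonzero point `z`, a simple pole makes the residue independent of the admissible morphism.
If f = g/D, then S = T·TS_z(f) is a power series with τ_z(D)·S = T·τ_z(g), while τ_z(g) ≡ g and
τ_z(D) ≡ D(z) + D'(z)T modulo T and T² respectively. The first two coefficients give D(z)s = 0, and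
D'(z)s = g if D(z) = 0 (`mk_mul_sres`, `mk_derivative_mul_sres`). So the residue vanishes off the
roots of D and is the class of g/D'(z) at a simple root. The same relations show that a denominator
of minimal degree has only simple nonzero roots (`PolesSeparable.exists_simple_roots`).

The section operators are F[Y]-linear, so they turn the noncommutative statement into the residue
theorem on the projective line for the differential h(Y) dY / D(Y), where h is the Laurent
polynomial sec_j(g). Partial fractions reduce it to h(Y) dY / (Y - z), and linearity to h = aY^i,
where it is read off geometric series (`evalAt_sec_add_coeff_sub_coeff`).

An admissible morphism amounts to an r-th root x ≡ X of z + T with the commutation rules of X. Take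
x = (1 + eu)X with u central and e of trace 1 over F: then x^r = P(u)Y, where P = ∏(1 + θ^i(e)U) has
coefficients in F and begins 1 + U + .... Hensel's lemma solves P(u) = 1 + T/z, in every
characteristic (`exists_root_add_X`). -/

noncomputable section

namespace SkewResidue

/-! ### Residues at nonzero points -/

section LocalExpansions

variable {K : Type*} [Field K] {θ : RingAut K}

theorem SkewLaurent.monomial_eq_C_mul (n : ℤ) (a : K) :
    monomial θ n a = C θ a * monomial θ n 1 := by
  change _ = monomial θ 0 a * _
  simp [monomial_mul_monomial]

theorem SkewLaurent.ringHom_ext {B : Type*} [Ring B] {φ ψ : SkewLaurent θ →+* B}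
    (hC : ∀ a, φ (C θ a) = ψ (C θ a)) (hX : φ (X θ) = ψ (X θ)) : φ = ψ := by
  have hpos (n : ℕ) : φ (monomial θ n 1) = ψ (monomial θ n 1) := by
    rw [← X_pow, map_pow, map_pow, hX]
  have hneg (n : ℕ) : φ (monomial θ (-n) 1) = ψ (monomial θ (-n) 1) := by
    -- Uniqueness of inverses: negative powers of X are determined by the positive ones.
    refine left_inv_eq_right_inv (a := φ (monomial θ n 1)) ?_ ?_
    · rw [← map_mul, monomial_mul_monomial]
      simp [← one_def]
    · rw [hpos, ← map_mul, monomial_mul_monomial]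
      simp [← one_def]
  have hall (n : ℤ) : φ (monomial θ n 1) = ψ (monomial θ n 1) := by
    obtain ⟨n, rfl | rfl⟩ := n.eq_nat_or_neg
    exacts [hpos n, hneg n]
  ext f
  induction f using SkewLaurent.induction_on with
  | h0 => simp
  | hm n a => rw [monomial_eq_C_mul, map_mul, map_mul, hC, hall]
  | ha f g hf hg => rw [map_add, map_add, hf, hg]

theorem powerSeries_coeff_one_mul {B : Type*} [Ring B] (p q : PowerSeries B) :
    PowerSeries.coeff 1 (p * q) = PowerSeries.constantCoeff p * PowerSeries.coeff 1 q +
      PowerSeries.coeff 1 p * PowerSeries.constantCoeff q := by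
  rw [PowerSeries.coeff_mul, Finset.Nat.sum_antidiagonal_eq_sum_range_succ_mk]
  simp [Finset.sum_range_succ]

namespace Admissible

variable {Fs : Type*} [Field Fs] [Algebra (FixedField θ) Fs] {z : Fs} (τ : Admissible θ z)

/-- The composite `𝒜 → lim 𝒜 / N^m 𝒜 → (𝒜 / N𝒜)[[T]]`. -/
def series : SkewLaurent θ →+* PowerSeries (SkewQuot θ (minpoly (FixedField θ) z)) :=
  τ.toRingHom.comp (toCompletion θ _)

theorem constantCoeff_series (g : SkewLaurent θ) :
    PowerSeries.constantCoeff (τ.series g) = Ideal.Quotient.mk _ g := by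
  refine RingHom.congr_fun (SkewLaurent.ringHom_ext (φ := PowerSeries.constantCoeff.comp τ.series)
    (ψ := Ideal.Quotient.mk _) (fun a => ?_) ?_) g
  · simp [series, τ.map_C]
  · exact τ.map_X

/-- This is D(z + T) = D(z) + D'(z)T + ..., obtained from the Leibniz rule because `τ` is prescribed
exactly on K and on Y. -/
theorem coeff_one_series_ofCentral (D : (FixedField θ)[X]) :
    PowerSeries.coeff 1 (τ.series (SkewLaurent.ofCentral θ D)) =
      Ideal.Quotient.mk _ (SkewLaurent.ofCentral θ (derivative D)) := by
  have hmul (p q : (FixedField θ)[X])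
      (hp : PowerSeries.coeff 1 (τ.series (SkewLaurent.ofCentral θ p)) =
        Ideal.Quotient.mk _ (SkewLaurent.ofCentral θ (derivative p)))
      (hq : PowerSeries.coeff 1 (τ.series (SkewLaurent.ofCentral θ q)) =
        Ideal.Quotient.mk _ (SkewLaurent.ofCentral θ (derivative q))) :
      PowerSeries.coeff 1 (τ.series (SkewLaurent.ofCentral θ (p * q))) =
        Ideal.Quotient.mk _ (SkewLaurent.ofCentral θ (derivative (p * q))) := by
    rw [map_mul, map_mul, powerSeries_coeff_one_mul, constantCoeff_series, constantCoeff_series, hp, hq,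
      derivative_mul, map_add, map_mul, map_mul, map_add, map_mul, map_mul, add_comm]
  induction D using Polynomial.induction_on with
  | C a =>
    simp [series, SkewLaurent.ofCentral_C, τ.map_C]
  | add p q hp hq => simp only [map_add, hp, hq]
  | monomial n a h =>
    rw [pow_succ, ← mul_assoc]
    refine hmul _ _ h ?_
    simp [series, SkewLaurent.ofCentral_X, τ.map_Y]

theorem ofPowerSeries_series (g : SkewLaurent θ) :
    HahnSeries.ofPowerSeries ℤ _ (τ.series g) = τ.expand g := rfl

variable [IsSepClosure (FixedField θ) Fs]

theorem expand_mul_taylor (g : SkewLaurent θ) (D : nonZeroDivisors (FixedField θ)[X]) :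
    τ.expand (SkewLaurent.ofCentral θ D) * τ.taylor (LocalizedModule.mk g D) = τ.expand g := by
  rw [taylor, fracLift_mk, ← mul_assoc, IsUnit.mul_val_inv, one_mul]

/-- A fraction with at most a simple pole at `z`, cleared of its denominator. -/
theorem exists_series_eq (g : SkewLaurent θ) (D : nonZeroDivisors (FixedField θ)[X])
    (h : ((-1 : ℤ) : WithTop ℤ) ≤ τ.ord (LocalizedModule.mk g D)) :
    ∃ S : PowerSeries (SkewQuot θ (minpoly (FixedField θ) z)),
      PowerSeries.constantCoeff S = τ.sres (LocalizedModule.mk g D) ∧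
      τ.series (SkewLaurent.ofCentral θ D) * S = PowerSeries.X * τ.series g := by
  set w := τ.taylor (LocalizedModule.mk g D) with hw
  -- The shift by one is multiplication by T; the order bound kills all coefficients of `w` below
  -- degree -1, so nothing is lost.
  have hS : HahnSeries.ofPowerSeries ℤ _ (PowerSeries.mk fun n => w.coeff ((n : ℤ) - 1)) =
      w * HahnSeries.single 1 1 := by
    ext n
    obtain ⟨m, rfl⟩ : ∃ m, n = m + 1 := ⟨n - 1, by ring⟩
    rw [HahnSeries.coeff_mul_single_add, mul_one]
    rcases le_or_gt 0 (m + 1) with hm | hm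
    · lift m + 1 to ℕ using hm with k hk
      rw [HahnSeries.ofPowerSeries_apply_coeff, PowerSeries.coeff_mk, hk, add_sub_cancel_right]
    · rw [PowerSeries.coeff_coe, if_pos hm, HahnSeries.coeff_eq_zero_of_lt_orderTop]
      refine lt_of_lt_of_le ?_ h
      exact_mod_cast (by omega : m < -1)
  refine ⟨PowerSeries.mk fun n => w.coeff ((n : ℤ) - 1), by simp [sres, hw], ?_⟩
  apply HahnSeries.ofPowerSeries_injective (Γ := ℤ)
  rw [← PowerSeries.X_mul.symm, map_mul, map_mul, hS, ofPowerSeries_series, ofPowerSeries_series,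
    HahnSeries.ofPowerSeries_X, ← mul_assoc, hw, expand_mul_taylor]

/-- Constant terms of τ(D)·S = T·τ(g). -/
theorem mk_mul_sres (g : SkewLaurent θ) (D : nonZeroDivisors (FixedField θ)[X])
    (h : ((-1 : ℤ) : WithTop ℤ) ≤ τ.ord (LocalizedModule.mk g D)) :
    Ideal.Quotient.mk _ (SkewLaurent.ofCentral θ D) * τ.sres (LocalizedModule.mk g D) = 0 := by
  obtain ⟨S, hS, hE⟩ := τ.exists_series_eq g D h
  simpa [constantCoeff_series, hS] using congrArg PowerSeries.constantCoeff hE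

/-- Coefficients of T in τ(D)·S = T·τ(g). The unknown next coefficient of S is multiplied by D(z),
which is zero here. -/
theorem mk_derivative_mul_sres (g : SkewLaurent θ) (D : nonZeroDivisors (FixedField θ)[X])
    (h : ((-1 : ℤ) : WithTop ℤ) ≤ τ.ord (LocalizedModule.mk g D))
    (hD : Ideal.Quotient.mk (centralIdeal θ (minpoly (FixedField θ) z))
      (SkewLaurent.ofCentral θ D) = 0) :
    Ideal.Quotient.mk _ (SkewLaurent.ofCentral θ (derivative (D : (FixedField θ)[X]))) *
      τ.sres (LocalizedModule.mk g D) = Ideal.Quotient.mk _ g := by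
  obtain ⟨S, hS, hE⟩ := τ.exists_series_eq g D h
  simpa [powerSeries_coeff_one_mul, constantCoeff_series, hS, hD, coeff_one_series_ofCentral] using
    congrArg (PowerSeries.coeff 1) hE

end Admissible

theorem mk_ofCentral_eq_zero {Fs : Type*} [Field Fs] [Algebra (FixedField θ) Fs] {z : Fs}
    {D : (FixedField θ)[X]} (hD : aeval z D = 0) :
    Ideal.Quotient.mk (centralIdeal θ (minpoly (FixedField θ) z))
      (SkewLaurent.ofCentral θ D) = 0 := by
  obtain ⟨E, rfl⟩ := minpoly.dvd _ _ hD
  rw [Ideal.Quotient.eq_zero_iff_mem, map_mul, (SkewLaurent.ofCentral_comm θ _ _).eq]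
  exact Ideal.mul_mem_left _ _ (Ideal.mem_span_singleton_self _)

open TensorProduct

/-! ### Passage to K ⊗ Fˢ and reduction to simple roots -/

section

variable {Fs : Type*} [Field Fs] [Algebra (FixedField θ) Fs]

/-- Evaluation `K[Y^{±1}] → K ⊗_F Fˢ` at a nonzero point `z`. -/
def evalAt (z : Fs) (hz : z ≠ 0) : LaurentPolynomial K →+* K ⊗[FixedField θ] Fs :=
  LaurentPolynomial.eval₂ (algebraMap K (K ⊗[FixedField θ] Fs))
      (Units.map (Algebra.TensorProduct.includeRight :
        Fs →ₐ[FixedField θ] K ⊗[FixedField θ] Fs).toRingHom.toMonoidHom (Units.mk0 z hz))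

theorem iota_secQuot_mk (hθ : IsOfFinOrder θ) (j : ℕ) (z : Fs) (hz : z ≠ 0) (g : SkewLaurent θ) :
    iota θ z hz (secQuot hθ j _ (Ideal.Quotient.mk _ g)) = evalAt z hz (sec hθ j g) := rfl

theorem evalAt_single (z : Fs) (hz : z ≠ 0) (i : ℤ) (a : K) :
    evalAt (θ := θ) z hz (AddMonoidAlgebra.single i a) = a ⊗ₜ (z ^ i) := by
  rw [LaurentPolynomial.single_eq_C_mul_T, map_mul, evalAt, LaurentPolynomial.eval₂_C,
    LaurentPolynomial.eval₂_T, ← map_zpow, Units.coe_map, Units.val_zpow_eq_zpow_val,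
    Units.val_mk0, Algebra.TensorProduct.algebraMap_apply]
  simp

theorem evalAt_centralToLaurent (z : Fs) (hz : z ≠ 0) (D : (FixedField θ)[X]) :
    evalAt (θ := θ) z hz (centralToLaurent θ D) = 1 ⊗ₜ aeval z D := by
  induction D using Polynomial.induction_on' with
  | add p q hp hq => rw [map_add, map_add, hp, hq, map_add, tmul_add]
  | monomial n c =>
    rw [centralToLaurent, RingHom.comp_apply, Polynomial.coe_mapRingHom, Polynomial.map_monomial,
      ← Polynomial.C_mul_X_pow_eq_monomial, map_mul, map_pow, Polynomial.toLaurent_C,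
      Polynomial.toLaurent_X, LaurentPolynomial.T_pow, ← LaurentPolynomial.single_eq_C_mul_T,
      evalAt_single, aeval_monomial, ← Algebra.smul_def, tmul_smul, smul_tmul']
    simp [Algebra.smul_def]
    rfl

/-- Since `sec` is linear over F[Y], the relations satisfied by `sres` carry over to K ⊗ Fˢ. That
ring need not be a field, but 1 ⊗ D(z) is a unit as soon as D(z) ≠ 0. -/
theorem iota_secQuot_mul (hθ : IsOfFinOrder θ) (j : ℕ) (z : Fs) (hz : z ≠ 0)
    (D : (FixedField θ)[X]) (s : SkewQuot θ (minpoly (FixedField θ) z)) :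
    iota θ z hz (secQuot hθ j _ (Ideal.Quotient.mk _ (SkewLaurent.ofCentral θ D) * s)) =
      1 ⊗ₜ aeval z D * iota θ z hz (secQuot hθ j _ s) := by
  obtain ⟨s, rfl⟩ := Ideal.Quotient.mk_surjective s
  rw [← map_mul, iota_secQuot_mk, iota_secQuot_mk, sec_ofCentral_mul, map_mul,
    evalAt_centralToLaurent]

theorem eq_one_tmul_inv_mul {x : Fs} (hx : x ≠ 0) {a b : K ⊗[FixedField θ] Fs}
    (h : 1 ⊗ₜ x * a = b) : a = 1 ⊗ₜ x⁻¹ * b := by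
  rw [← h, ← mul_assoc, Algebra.TensorProduct.tmul_mul_tmul, inv_mul_cancel₀ hx, mul_one,
    ← Algebra.TensorProduct.one_def, one_mul]

variable [IsSepClosure (FixedField θ) Fs]

theorem Admissible.partialRes_eq_zero (hθ : IsOfFinOrder θ) {z : Fs} (τ : Admissible θ z)
    (hz : z ≠ 0) (j : ℕ) (g : SkewLaurent θ) (D : nonZeroDivisors (FixedField θ)[X])
    (h : ((-1 : ℤ) : WithTop ℤ) ≤ τ.ord (LocalizedModule.mk g D))
    (hD : aeval z (D : (FixedField θ)[X]) ≠ 0) :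
    τ.partialRes hθ hz j (LocalizedModule.mk g D) = 0 := by
  rw [← mul_zero (1 ⊗ₜ (aeval z (D : (FixedField θ)[X]))⁻¹)]
  refine eq_one_tmul_inv_mul hD ?_
  rw [partialRes, ← iota_secQuot_mul, τ.mk_mul_sres g D h, map_zero, map_zero]

/-- The classical formula g(z)/D'(z). Its right-hand side does not involve `τ`, which is why the
choice of admissible morphisms is harmless. -/
theorem Admissible.partialRes_eq_of_root (hθ : IsOfFinOrder θ) {z : Fs} (τ : Admissible θ z)
    (hz : z ≠ 0) (j : ℕ) (g : SkewLaurent θ) (D : nonZeroDivisors (FixedField θ)[X])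
    (h : ((-1 : ℤ) : WithTop ℤ) ≤ τ.ord (LocalizedModule.mk g D))
    (hD : aeval z (D : (FixedField θ)[X]) = 0)
    (hD' : aeval z (derivative (D : (FixedField θ)[X])) ≠ 0) :
    τ.partialRes hθ hz j (LocalizedModule.mk g D) =
      1 ⊗ₜ (aeval z (derivative (D : (FixedField θ)[X])))⁻¹ * evalAt z hz (sec hθ j g) := by
  refine eq_one_tmul_inv_mul hD' ?_
  rw [partialRes, ← iota_secQuot_mul, τ.mk_derivative_mul_sres g D h (mk_ofCentral_eq_zero hD),
    iota_secQuot_mk]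

variable (Fs) in
/-- The denominator of a fraction with separable poles, and at most simple poles away from `0`
and `∞`, can be chosen with simple and nonzero roots. -/
theorem PolesSeparable.exists_simple_roots {f : SkewFrac θ} (hf : PolesSeparable Fs f)
    (τ : ∀ z : Fs, z ≠ 0 → Admissible θ z)
    (h : ∀ (z : Fs) (hz : z ≠ 0), ((-1 : ℤ) : WithTop ℤ) ≤ (τ z hz).ord f) :
    ∃ (g : SkewLaurent θ) (D : nonZeroDivisors (FixedField θ)[X]),
      f = LocalizedModule.mk g D ∧
      ((D : (FixedField θ)[X]).map (algebraMap (FixedField θ) Fs)).Splits ∧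
      (∀ z : Fs, aeval z (D : (FixedField θ)[X]) = 0 →
        z ≠ 0 ∧ aeval z (derivative (D : (FixedField θ)[X])) ≠ 0) := by
  classical
  -- Among all denominators that split over `Fs`, take one of least degree; `hmin` then forbids a
  -- nonconstant central factor common to `g` and `D`.
  let P (n : ℕ) : Prop := ∃ (g : SkewLaurent θ) (D : nonZeroDivisors (FixedField θ)[X]),
    f = LocalizedModule.mk g D ∧
      ((D : (FixedField θ)[X]).map (algebraMap (FixedField θ) Fs)).Splits ∧
      (D : (FixedField θ)[X]).natDegree = n
  have hP : ∃ n, P n := by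
    obtain ⟨g, D, h1, h2⟩ := hf
    exact ⟨_, g, D, h1, h2, rfl⟩
  obtain ⟨g, D, hfD, hs, hn⟩ := Nat.find_spec hP
  have hmin {N E : (FixedField θ)[X]} {g' : SkewLaurent θ} (hD : (D : (FixedField θ)[X]) = N * E)
      (hg : g = SkewLaurent.ofCentral θ N * g') (hN : 0 < N.natDegree) : False := by
    have hD0 : N * E ≠ 0 := hD ▸ nonZeroDivisors.coe_ne_zero D
    have hN0 := left_ne_zero_of_mul hD0
    have hE0 := right_ne_zero_of_mul hD0
    refine Nat.find_min hP (m := E.natDegree) ?_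
      ⟨g', ⟨E, mem_nonZeroDivisors_of_ne_zero hE0⟩, ?_, ?_, rfl⟩
    · rw [← hn, hD, natDegree_mul hN0 hE0]
      omega
    · rw [hfD, LocalizedModule.mk_eq]
      refine ⟨1, ?_⟩
      simp only [Submonoid.smul_def, Algebra.smul_def, SkewLaurent.algebraMap_def, hD, hg,
        ← mul_assoc, ← map_mul, mul_comm, OneMemClass.coe_one]
    · rw [hD, Polynomial.map_mul] at hs
      refine hs.of_dvd ?_ (Dvd.intro_left _ rfl)
      rw [← Polynomial.map_mul]
      exact (Polynomial.map_ne_zero_iff (algebraMap (FixedField θ) Fs).injective).2 hD0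
  refine ⟨g, D, hfD, hs, fun z hzD => ?_⟩
  have hz : z ≠ 0 := by
    rintro rfl
    have hX : Polynomial.X ∣ (D : (FixedField θ)[X]) := by
      rw [X_dvd_iff]
      rw [aeval_def, eval₂_at_zero] at hzD
      exact (map_eq_zero _).1 hzD
    obtain ⟨E, hE⟩ := hX
    -- Y is a unit of 𝒜, hence divides every numerator.
    refine hmin (g' := SkewLaurent.monomial θ (-orderOf θ) 1 * g) hE ?_ (by simp)
    rw [SkewLaurent.ofCentral_X, SkewLaurent.Y_eq, ← mul_assoc, SkewLaurent.monomial_mul_monomial]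
    simp [← SkewLaurent.one_def]
  refine ⟨hz, fun hz' => ?_⟩
  -- At a multiple root the relation D'(z)s = g becomes g = 0 modulo N, so N divides both `g` and
  -- `D`.
  have hg : Ideal.Quotient.mk (centralIdeal θ (minpoly (FixedField θ) z)) g = 0 := by
    rw [← (τ z hz).mk_derivative_mul_sres g D (hfD ▸ h z hz) (mk_ofCentral_eq_zero hzD),
      mk_ofCentral_eq_zero hz', zero_mul]
  rw [Ideal.Quotient.eq_zero_iff_mem] at hg
  obtain ⟨g', hg'⟩ := Ideal.mem_span_singleton'.1 hg
  obtain ⟨E, hE⟩ := minpoly.dvd _ _ hzD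
  exact hmin hE (hg'.symm.trans (SkewLaurent.ofCentral_comm θ _ _).eq.symm)
    (minpoly.natDegree_pos (Admissible.isIntegral_of_isSepClosure z))

end

end LocalExpansions

/-! ### Partial fractions -/

section ResidueFormula

open TensorProduct

/-- This is 1/P(y) = q + ∑ 1/(P'(z)(y - z)), obtained from Lagrange interpolation of the constant 1
at the roots of P. The target ring may have zero divisors, so the inverses of y - z are data. The
constant `q` is chosen before `y`: the same one must serve at 0 and at ∞, where its contributions
cancel. -/
theorem exists_eval₂_mul_partialFractions {L S : Type*} [Field L] [DecidableEq L] [CommRing S]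
    (η : L →+* S) {P : L[X]} (hP : P ≠ 0) (hs : P.Splits)
    (hroots : ∀ z, P.eval z = 0 → (derivative P).eval z ≠ 0) :
    ∃ q : L, ∀ (y : S) (v : L → S), (∀ z ∈ P.roots.toFinset, (y - η z) * v z = 1) →
      P.eval₂ η y *
        (η q + ∑ z ∈ P.roots.toFinset, η ((derivative P).eval z)⁻¹ * v z) = 1 := by
  set s := P.roots.toFinset with hsdef
  have hlc : P.leadingCoeff ≠ 0 := leadingCoeff_ne_zero.2 hP
  have hnodup : P.roots.Nodup := by
    refine Multiset.nodup_iff_count_le_one.2 fun z => ?_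
    rw [count_roots]
    by_contra! h
    have h2 := (one_lt_rootMultiplicity_iff_isRoot hP).1 h
    exact hroots z h2.1 h2.2
  have hfact : P = C P.leadingCoeff * Lagrange.nodal s id := by
    conv_lhs => rw [hs.eq_prod_roots]
    rw [Lagrange.nodal_eq, hsdef, Finset.prod, Multiset.toFinset_val, hnodup.dedup]
    rfl
  have hder {z : L} (hz : z ∈ s) : Lagrange.nodalWeight s id z =
      P.leadingCoeff * ((derivative P).eval z)⁻¹ := by
    rw [Lagrange.nodalWeight_eq_eval_derivative_nodal hz]
    have h : (derivative P).eval z =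
        P.leadingCoeff * (derivative (Lagrange.nodal s id)).eval z := by
      conv_lhs => rw [hfact]
      simp
    rw [h, mul_inv, mul_inv_cancel_left₀ hlc]
    rfl
  -- Without roots P is constant and interpolation says nothing; this is the only case that needs `q
  -- ≠ 0`.
  rcases s.eq_empty_or_nonempty with h0 | hne
  · refine ⟨P.leadingCoeff⁻¹, fun y v _ => ?_⟩
    rw [h0, Finset.sum_empty, add_zero, hfact, h0]
    simp [← map_mul, hlc]
  · refine ⟨0, fun y v hv => ?_⟩
    have hsum := Lagrange.sum_basis (v := (id : L → L)) (Set.injOn_id (s : Set L)) hne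
    rw [map_zero, zero_add, Finset.mul_sum, ← eval₂_one η y, ← hsum, eval₂_finsetSum]
    refine Finset.sum_congr rfl fun z hz => ?_
    rw [Lagrange.basis_eq_prod_sub_inv_mul_nodal_div hz, ← Lagrange.nodal_erase_eq_nodal_div hz,
      hder hz, eval₂_mul, eval₂_C, map_mul]
    have hPy : P.eval₂ η y = η P.leadingCoeff *
        ((y - η z) * (Lagrange.nodal (s.erase z) id).eval₂ η y) := by
      conv_lhs => rw [hfact, Lagrange.nodal_eq_mul_nodal_erase hz]
      rw [eval₂_mul, eval₂_C, eval₂_mul, eval₂_sub, eval₂_X, eval₂_C, id]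
    rw [hPy]
    have := hv z hz
    linear_combination (η P.leadingCoeff * η ((derivative P).eval z)⁻¹ *
      (Lagrange.nodal (s.erase z) id).eval₂ η y) * this

theorem exists_coeff_eq_partialFractions {L R : Type*} [Field L] [DecidableEq L] [CommRing R]
    (κ : L →+* R) {P : L[X]} (hP : P ≠ 0) (hs : P.Splits)
    (hroots : ∀ z, P.eval z = 0 → (derivative P).eval z ≠ 0) :
    ∃ q : L, ∀ (y : HahnSeries ℤ R) (v : L → HahnSeries ℤ R),
      (∀ z ∈ P.roots.toFinset, (y - HahnSeries.C (κ z)) * v z = 1) →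
      ∀ w h : HahnSeries ℤ R, P.eval₂ (HahnSeries.C.comp κ) y * w = h → ∀ k : ℤ,
        w.coeff k = κ q * h.coeff k +
          ∑ z ∈ P.roots.toFinset, κ ((derivative P).eval z)⁻¹ * (v z * h).coeff k := by
  obtain ⟨q, hq⟩ := exists_eval₂_mul_partialFractions
    (S := HahnSeries ℤ R) (HahnSeries.C.comp κ) hP hs hroots
  refine ⟨q, fun y v hv w h hw k => ?_⟩
  have h2 : w = (HahnSeries.C (κ q) + ∑ z ∈ P.roots.toFinset,
      HahnSeries.C (κ ((derivative P).eval z)⁻¹) * v z) * h := by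
    rw [← hw, ← mul_assoc, mul_comm _ (P.eval₂ _ y)]
    exact ((congrArg (· * w) (hq y v hv)).trans (one_mul w)).symm
  rw [h2, add_mul, HahnSeries.coeff_add, Finset.sum_mul, HahnSeries.coeff_sum,
    HahnSeries.C_mul_eq_smul, HahnSeries.coeff_smul, smul_eq_mul]
  congr 1
  refine Finset.sum_congr rfl fun z _ => ?_
  rw [mul_assoc, HahnSeries.C_mul_eq_smul, HahnSeries.coeff_smul, smul_eq_mul]

/-! ### Sections of skew Laurent series -/

variable {K : Type*} [Field K]

theorem SkewSeries.coeff_monomial_mul (θ : RingAut K) (n m : ℤ) (c : K) (w : SkewSeries θ) :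
    (monomial θ n c * w).coeff (n + m) = c * (θ ^ n) (w.coeff m) := by
  have hm : toLaurent θ (monomial θ n c) = HahnSeries.single n (SkewLaurent.monomial θ n c) := by
    ext k
    change SkewLaurent.monomial θ k ((HahnSeries.single n c).coeff k) = _
    rw [HahnSeries.coeff_single, HahnSeries.coeff_single]
    split_ifs with h
    · rw [h]
    · exact SkewMonoidAlgebra.single_zero _
  have h := congrArg (fun f => HahnSeries.coeff f (n + m)) (toLaurent_mul θ (monomial θ n c) w)
  simp only [hm] at h
  rw [add_comm n m, HahnSeries.coeff_single_mul_add] at h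
  rw [add_comm n m]
  apply monomial_inj θ (n := m + n)
  refine h.trans ?_
  change SkewLaurent.monomial θ n c * SkewLaurent.monomial θ m (w.coeff m) = _
  rw [SkewLaurent.monomial_mul_monomial, add_comm]

/-- The section `∑ a_i X^i ↦ ∑ ι(a_{m+ir}) T^i` of a skew Laurent series. -/
def secSeries {R : Type*} [CommRing R] (ι : K →+* R) {θ : RingAut K} {r : ℕ} (hr : 0 < r) (m : ℤ) :
    SkewSeries θ →+ HahnSeries ℤ R where
  toFun w :=
    { coeff := fun i => ι (w.coeff (m + i * r))
      isPWO_support' := fun f => by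
        obtain ⟨a, b, hab, h⟩ := w.isPWO fun n =>
          ⟨m + (f n : ℤ) * r, fun h0 => (f n).2 (by simp [h0])⟩
        refine ⟨a, b, hab, ?_⟩
        have hr' : (0 : ℤ) < r := by exact_mod_cast hr
        exact le_of_mul_le_mul_right (le_of_add_le_add_left h) hr' }
  map_zero' := by
    ext i
    exact map_zero ι
  map_add' w w' := by
    ext i
    exact map_add ι _ _

section

variable {R : Type*} [CommRing R] (ι : K →+* R) {θ : RingAut K} {r : ℕ} (hr : 0 < r) (m : ℤ)

theorem coeff_secSeries (w : SkewSeries θ) (i : ℤ) :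
    (secSeries ι hr m w).coeff i = ι (w.coeff (m + i * r)) := rfl

/-- In exponents divisible by r the twist is trivial, so the product is the commutative one. -/
theorem secSeries_monomial_mul (hθr : θ ^ r = 1) (k : ℤ) (c : K) (w : SkewSeries θ) :
    secSeries ι hr m (SkewSeries.monomial θ (r * k) c * w) =
      HahnSeries.single k (ι c) * secSeries ι hr m w := by
  ext i
  obtain ⟨i, rfl⟩ : ∃ i', i = i' + k := ⟨i - k, by ring⟩
  rw [coeff_secSeries, HahnSeries.coeff_single_mul_add, coeff_secSeries,
    show m + (i + k) * r = r * k + (m + i * r) by ring, SkewSeries.coeff_monomial_mul,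
    zpow_mul, zpow_natCast, hθr, one_zpow, map_mul]
  rfl

theorem secSeries_monomial (i : ℤ) (a : K) :
    secSeries ι hr m (SkewSeries.monomial θ (m + i * r) a) = HahnSeries.single i (ι a) := by
  ext k
  rw [coeff_secSeries, HahnSeries.coeff_single]
  change ι ((HahnSeries.single _ a).coeff _) = _
  rw [HahnSeries.coeff_single, apply_ite ι, map_zero]
  have : m + k * r = m + i * r ↔ k = i := by
    simp [hr.ne']
  simp only [this]
  split_ifs <;> rfl

theorem secSeries_monomial_of_ne {n : ℤ} (hn : ∀ i : ℤ, n ≠ m + i * r) (a : K) :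
    secSeries ι hr m (SkewSeries.monomial θ n a) = 0 := by
  ext k
  rw [coeff_secSeries]
  change ι ((HahnSeries.single _ a).coeff _) = _
  rw [HahnSeries.coeff_single, if_neg (hn k).symm, map_zero]
  rfl

end

/-- Treats both ends together: `ε` is 1 at 0 and -1 at ∞, and Y acts on sections as T^ε. -/
theorem secSeries_expand_ofCentral_mul {R : Type*} [CommRing R] (ι : K →+* R) {θ θ' : RingAut K}
    (hθ : 0 < orderOf θ) (hθ' : θ' ^ orderOf θ = 1) (E : SkewLaurent θ →+* SkewSeries θ') (ε : ℤ)
    (hE : ∀ n a, E (SkewLaurent.monomial θ n a) = SkewSeries.monomial θ' (ε * n) a)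
    (m : ℤ) (D : (FixedField θ)[X]) (w : SkewSeries θ') :
    secSeries ι hθ m (E (SkewLaurent.ofCentral θ D) * w) =
      D.eval₂ (HahnSeries.C.comp (ι.comp (FixedField θ).subtype)) (HahnSeries.single ε 1) *
        secSeries ι hθ m w := by
  induction D using Polynomial.induction_on' with
  | add p q hp hq => rw [map_add, map_add, add_mul, map_add, hp, hq, eval₂_add, add_mul]
  | monomial n c =>
    rw [SkewLaurent.ofCentral_monomial, hE, show ε * ((orderOf θ * n : ℕ) : ℤ) =
      (orderOf θ : ℤ) * (n * ε) by push_cast; ring, secSeries_monomial_mul ι hθ m hθ',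
      eval₂_monomial, HahnSeries.single_pow]
    congr 1
    change _ = HahnSeries.single 0 (ι c) * _
    simp [HahnSeries.single_mul_single]

/-! ### Geometric series at 0 and at infinity -/

section Geometric

variable {R : Type*} [CommRing R]

/-- The expansion of `1 / (T - u)` at `0`. -/
def geomZero (u : Rˣ) : HahnSeries ℤ R :=
  HahnSeries.ofSuppBddBelow (fun k => if 0 ≤ k then -((u ^ (-k - 1) : Rˣ) : R) else 0)
    ⟨0, fun k hk => by by_contra h; exact hk (if_neg h)⟩

/-- The expansion of `1 / (T⁻¹ - u)` at `0`. -/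
def geomInfty (u : Rˣ) : HahnSeries ℤ R :=
  HahnSeries.ofSuppBddBelow (fun k => if 1 ≤ k then ((u ^ (k - 1) : Rˣ) : R) else 0)
    ⟨1, fun k hk => by by_contra h; exact hk (if_neg h)⟩

theorem coeff_geomZero (u : Rˣ) (k : ℤ) :
    (geomZero u).coeff k = if 0 ≤ k then -((u ^ (-k - 1) : Rˣ) : R) else 0 := rfl

theorem coeff_geomInfty (u : Rˣ) (k : ℤ) :
    (geomInfty u).coeff k = if 1 ≤ k then ((u ^ (k - 1) : Rˣ) : R) else 0 := rfl

/-- The coefficients obey a recursion that telescopes; only degree 0, where the truncation starts,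
leaves a term. -/
theorem sub_mul_geomZero (u : Rˣ) :
    (HahnSeries.single 1 1 - HahnSeries.C (u : R)) * geomZero u = 1 := by
  ext k
  obtain ⟨k, rfl⟩ : ∃ k', k = k' + 1 := ⟨k - 1, by ring⟩
  rw [sub_mul, HahnSeries.coeff_sub, HahnSeries.coeff_single_mul_add, HahnSeries.C_mul_eq_smul,
    HahnSeries.coeff_smul, coeff_geomZero, coeff_geomZero, HahnSeries.coeff_one,
    one_mul, smul_eq_mul]
  rcases lt_trichotomy (k + 1) 0 with h | h | h
  · rw [if_neg (by omega), if_neg (by omega), if_neg (by omega)]; simp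
  · rw [if_neg (by omega), if_pos (by omega), if_pos (by omega), h]; simp
  · rw [if_pos (by omega), if_pos (by omega), if_neg (by omega), mul_neg, ← Units.val_mul,
      ← zpow_one_add, show 1 + (-(k + 1) - 1) = -k - 1 by ring]
    simp

theorem sub_mul_geomInfty (u : Rˣ) :
    (HahnSeries.single (-1) 1 - HahnSeries.C (u : R)) * geomInfty u = 1 := by
  ext k
  obtain ⟨k, rfl⟩ : ∃ k', k = k' + (-1) := ⟨k + 1, by ring⟩
  rw [sub_mul, HahnSeries.coeff_sub, HahnSeries.coeff_single_mul_add, HahnSeries.C_mul_eq_smul,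
    HahnSeries.coeff_smul, coeff_geomInfty, coeff_geomInfty, HahnSeries.coeff_one,
    one_mul, smul_eq_mul]
  rcases lt_trichotomy k 1 with h | h | h
  · rw [if_neg (by omega), if_neg (by omega), if_neg (by omega)]; simp
  · rw [if_pos (by omega), if_neg (by omega), if_pos (by omega), h]; simp
  · rw [if_pos (by omega), if_pos (by omega), if_neg (by omega), ← Units.val_mul,
      ← zpow_one_add, show 1 + (k + -1 - 1) = k - 1 by ring]
    simp

end Geometric

/-! ### The residue formula for simple nonzero roots -/

section

variable {θ : RingAut K} {Fs : Type*} [Field Fs] [Algebra (FixedField θ) Fs]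

/-- The image `1 ⊗ z` of a nonzero point `z`, as a unit. -/
def unitAt (θ : RingAut K) [Algebra (FixedField θ) Fs] (z : Fs) (hz : z ≠ 0) :
    (K ⊗[FixedField θ] Fs)ˣ :=
  Units.map (Algebra.TensorProduct.includeRight :
    Fs →ₐ[FixedField θ] K ⊗[FixedField θ] Fs).toRingHom.toMonoidHom (Units.mk0 z hz)

theorem unitAt_zpow (z : Fs) (hz : z ≠ 0) (i : ℤ) :
    ((unitAt θ z hz ^ i : (K ⊗[FixedField θ] Fs)ˣ) : K ⊗[FixedField θ] Fs) = 1 ⊗ₜ (z ^ i) := by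
  rw [unitAt, ← map_zpow, Units.coe_map, Units.val_zpow_eq_zpow_val, Units.val_mk0]
  rfl

/-- The residue formula for `h(Y) dY / (Y - z)`, with `h = sec_j g`. -/
theorem evalAt_sec_add_coeff_sub_coeff (hθ : IsOfFinOrder θ) (j : ℕ) (z : Fs) (hz : z ≠ 0)
    (g : SkewLaurent θ) :
    evalAt z hz (sec hθ j g) +
      (geomZero (unitAt θ z hz) * secSeries (algebraMap K (K ⊗[FixedField θ] Fs)) hθ.orderOf_pos j
        (expandZero θ g)).coeff (-1) -
      (geomInfty (unitAt θ z hz) * secSeries (algebraMap K (K ⊗[FixedField θ] Fs)) hθ.orderOf_pos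
        (-j) (expandInfty θ g)).coeff 1 = 0 := by
  classical
  induction g using SkewLaurent.induction_on with
  | h0 => simp
  | ha f g hf hg =>
    simp only [map_add, mul_add, HahnSeries.coeff_add]
    linear_combination hf + hg
  | hm n a =>
    rw [expandZero_monomial, expandInfty_monomial]
    -- Exponents not congruent to j modulo r vanish in all three terms.
    by_cases hn : ∃ i : ℤ, n = j + i * orderOf θ
    · obtain ⟨i, rfl⟩ := hn
      have hsec : sec hθ j (SkewLaurent.monomial θ (j + i * orderOf θ) a) =
          AddMonoidAlgebra.single i a := by
        ext k
        rw [coeff_sec, SkewLaurent.coeff_monomial, AddMonoidAlgebra.coeff_single,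
          Finsupp.single_apply, Finsupp.single_apply]
        have : (j : ℤ) + i * orderOf θ = j + k * orderOf θ ↔ i = k := by
          simp [hθ.orderOf_pos.ne']
        simp only [this]
      rw [hsec, evalAt_single, secSeries_monomial,
        show -((j : ℤ) + i * orderOf θ) = -j + (-i) * orderOf θ by ring, secSeries_monomial]
      have hshift (x : HahnSeries ℤ (K ⊗[FixedField θ] Fs)) (b : K ⊗[FixedField θ] Fs)
          (k l : ℤ) : (x * HahnSeries.single l b).coeff k = x.coeff (k - l) * b := by
        rw [← HahnSeries.coeff_mul_single_add, sub_add_cancel]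
      rw [hshift, hshift, coeff_geomZero, coeff_geomInfty, sub_neg_eq_add]
      have ht : (1 : K) ⊗ₜ[FixedField θ] (z ^ i) * algebraMap K (K ⊗[FixedField θ] Fs) a =
          a ⊗ₜ (z ^ i) := by
        rw [Algebra.TensorProduct.algebraMap_apply, Algebra.TensorProduct.tmul_mul_tmul]
        simp
      -- For aY^i dY/(Y - z), the residue at `z` is balanced at ∞ if i ≥ 0 and at 0 if i < 0, never
      -- at both.
      rcases le_or_gt 0 i with hi | hi
      · rw [if_neg (by omega), if_pos (by omega), unitAt_zpow, add_sub_cancel_left, ht]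
        simp
      · rw [if_pos (by omega), if_neg (by omega), unitAt_zpow,
          show -(-1 - i) - 1 = i by ring]
        linear_combination -ht
    · push Not at hn
      have hsec : sec hθ j (SkewLaurent.monomial θ n a) = 0 := by
        ext k
        rw [coeff_sec, SkewLaurent.coeff_monomial, Finsupp.single_apply, if_neg (hn k)]
        rfl
      rw [hsec, secSeries_monomial_of_ne _ _ _ hn, secSeries_monomial_of_ne]
      · simp
      · intro i h
        exact hn (-i) (by linear_combination -h)

theorem expandZero_mul_taylorZero (hθ : IsOfFinOrder θ) (g : SkewLaurent θ)
    (D : nonZeroDivisors (FixedField θ)[X]) :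
    expandZero θ (SkewLaurent.ofCentral θ D) * taylorZero hθ (LocalizedModule.mk g D) =
      expandZero θ g := by
  rw [taylorZero, fracLift_mk, ← mul_assoc, IsUnit.mul_val_inv, one_mul]

theorem expandInfty_mul_taylorInfty (hθ : IsOfFinOrder θ) (g : SkewLaurent θ)
    (D : nonZeroDivisors (FixedField θ)[X]) :
    expandInfty θ (SkewLaurent.ofCentral θ D) * taylorInfty hθ (LocalizedModule.mk g D) =
      expandInfty θ g := by
  rw [taylorInfty, fracLift_mk, ← mul_assoc, IsUnit.mul_val_inv, one_mul]

open Classical in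
/-- The residue formula for a fraction `g / D` such that `D` has simple nonzero roots, the
residues at these roots being computed by derivatives. -/
theorem sum_roots_add_partialResZero_add_partialResInfty (hθ : IsOfFinOrder θ) (j : ℕ)
    (g : SkewLaurent θ) (D : nonZeroDivisors (FixedField θ)[X])
    (hs : ((D : (FixedField θ)[X]).map (algebraMap (FixedField θ) Fs)).Splits)
    (hroots : ∀ z : Fs, aeval z (D : (FixedField θ)[X]) = 0 →
        z ≠ 0 ∧ aeval z (derivative (D : (FixedField θ)[X])) ≠ 0) :
    ∑ z ∈ ((D : (FixedField θ)[X]).map (algebraMap (FixedField θ) Fs)).roots.toFinset,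
      (1 ⊗ₜ (aeval z (derivative (D : (FixedField θ)[X])))⁻¹ *
        if hz : z ≠ 0 then evalAt z hz (sec hθ j g) else 0) +
      algebraMap K (K ⊗[FixedField θ] Fs) (partialResZero hθ j (LocalizedModule.mk g D)) +
      algebraMap K (K ⊗[FixedField θ] Fs) (partialResInfty hθ j (LocalizedModule.mk g D)) = 0 := by
  set ι := algebraMap K (K ⊗[FixedField θ] Fs)
  let κ : Fs →+* K ⊗[FixedField θ] Fs := (Algebra.TensorProduct.includeRight :
    Fs →ₐ[FixedField θ] K ⊗[FixedField θ] Fs).toRingHom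
  set P := (D : (FixedField θ)[X]).map (algebraMap (FixedField θ) Fs) with hPdef
  have hP : P ≠ 0 := (Polynomial.map_ne_zero_iff (algebraMap (FixedField θ) Fs).injective).2
    (nonZeroDivisors.coe_ne_zero D)
  have hPev (z : Fs) : P.eval z = aeval z (D : (FixedField θ)[X]) := eval_map_algebraMap _ _
  have hPder (z : Fs) : (derivative P).eval z =
      aeval z (derivative (D : (FixedField θ)[X])) := by
    rw [hPdef, derivative_map, eval_map_algebraMap]
  have hnz {z : Fs} (hz : z ∈ P.roots.toFinset) : z ≠ 0 :=
    (hroots z (by rw [← hPev]; exact (mem_roots hP).1 (Multiset.mem_toFinset.1 hz))).1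
  obtain ⟨q, hq⟩ := exists_coeff_eq_partialFractions κ hP hs fun z hz => by
    rw [hPder]
    exact (hroots z (by rw [← hPev, hz])).2
  have hcoef : HahnSeries.C.comp (ι.comp (FixedField θ).subtype) =
      ((HahnSeries.C (Γ := ℤ)).comp κ).comp (algebraMap (FixedField θ) Fs) := by
    ext1 a
    refine congrArg HahnSeries.C ?_
    exact ((Algebra.TensorProduct.includeRight :
          Fs →ₐ[FixedField θ] K ⊗[FixedField θ] Fs).commutes a).symm
  -- Solves D(y)·w = h by partial fractions, for y = T and y = T⁻¹ alike; `v` expands 1/(y - u).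
  have hsolve (y : HahnSeries ℤ (K ⊗[FixedField θ] Fs))
      (v : (K ⊗[FixedField θ] Fs)ˣ → HahnSeries ℤ (K ⊗[FixedField θ] Fs))
      (hv : ∀ u : (K ⊗[FixedField θ] Fs)ˣ, (y - HahnSeries.C (u : K ⊗[FixedField θ] Fs)) * v u = 1)
      (w h : HahnSeries ℤ (K ⊗[FixedField θ] Fs))
      (hw : (D : (FixedField θ)[X]).eval₂ (HahnSeries.C.comp (ι.comp (FixedField θ).subtype)) y * w
        = h) (k : ℤ) :
      w.coeff k = κ q * h.coeff k + ∑ z ∈ P.roots.toFinset,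
        1 ⊗ₜ (aeval z (derivative (D : (FixedField θ)[X])))⁻¹ *
          if hz : z ≠ 0 then (v (unitAt θ z hz) * h).coeff k else 0 := by
    rw [hcoef, ← eval₂_map] at hw
    -- The default value 0 is never used, since 0 is not a root.
    rw [hq y (fun z => if hz : z ≠ 0 then v (unitAt θ z hz) else 0) (fun z hz => ?_) w h hw k]
    · congr 1
      refine Finset.sum_congr rfl fun z hz => ?_
      rw [dif_pos (hnz hz), dif_pos (hnz hz), hPder]
      rfl
    · rw [dif_pos (hnz hz)]
      exact hv (unitAt θ z (hnz hz))
  have hzero := hsolve _ _ sub_mul_geomZero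
    (secSeries ι hθ.orderOf_pos j (taylorZero hθ (LocalizedModule.mk g D)))
    (secSeries ι hθ.orderOf_pos j (expandZero θ g)) (by
      rw [← expandZero_mul_taylorZero hθ g D,
        secSeries_expand_ofCentral_mul ι hθ.orderOf_pos (pow_orderOf_eq_one θ) _ 1]
      simp [expandZero_monomial]) (-1)
  have hinfty := hsolve _ _ sub_mul_geomInfty
    (secSeries ι hθ.orderOf_pos (-j) (taylorInfty hθ (LocalizedModule.mk g D)))
    (secSeries ι hθ.orderOf_pos (-j) (expandInfty θ g)) (by
      rw [← expandInfty_mul_taylorInfty hθ g D,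
        secSeries_expand_ofCentral_mul ι hθ.orderOf_pos (by simp [pow_orderOf_eq_one]) _ (-1)]
      simp [expandInfty_monomial]) 1
  -- Both constant terms of the partial fractions multiply the coefficient of X^(j-r) in `g`. The
  -- sign in the residue at ∞ cancels them, leaving one residue formula for each root.
  have hconst : (secSeries ι hθ.orderOf_pos j (expandZero θ g)).coeff (-1) =
      (secSeries ι hθ.orderOf_pos (-j) (expandInfty θ g)).coeff 1 := by
    rw [coeff_secSeries, coeff_secSeries, coeff_expandZero, coeff_expandInfty]
    congr 2
    ring
  have h0 : partialResZero hθ j (LocalizedModule.mk g D) =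
      (taylorZero hθ (LocalizedModule.mk g D)).coeff (j + -1 * orderOf θ) := by
    rw [partialResZero, neg_one_mul, sub_eq_add_neg]
  have h1 : partialResInfty hθ j (LocalizedModule.mk g D) =
      -(taylorInfty hθ (LocalizedModule.mk g D)).coeff (-j + 1 * orderOf θ) := by
    rw [partialResInfty, one_mul, neg_add_eq_sub]
  rw [coeff_secSeries] at hzero hinfty
  rw [h0, h1, map_neg, hzero, hinfty, hconst]
  rw [← sub_eq_add_neg, add_sub_assoc, add_sub_add_left_eq_sub, ← Finset.sum_sub_distrib,
    ← Finset.sum_add_distrib]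
  refine Finset.sum_eq_zero fun z hz => ?_
  rw [dif_pos (hnz hz), dif_pos (hnz hz), dif_pos (hnz hz), ← mul_sub, ← mul_add, ← add_sub_assoc,
    evalAt_sec_add_coeff_sub_coeff, mul_zero]

end

end ResidueFormula

/-! ### Hensel's lemma in L[[T]] -/

section PowerSeries

/-- Modulo T, 0 is a root of P - (1 + S), and it is simple because P'(0) = 1; Hensel's lemma lifts
it. -/
theorem exists_eval₂_eq_one_add {L : Type*} [Field L] {P : L[X]} (h0 : P.coeff 0 = 1)
    (h1 : P.coeff 1 = 1) {S : PowerSeries L} (hS : PowerSeries.constantCoeff S = 0) :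
    ∃ t : PowerSeries L, PowerSeries.constantCoeff t = 0 ∧ P.eval₂ PowerSeries.C t = 1 + S := by
  have hP : P ≠ 0 := by
    rintro rfl
    simp at h0
  have hlc : P.leadingCoeff ≠ 0 := leadingCoeff_ne_zero.2 hP
  have hdeg : 0 < P.degree := by
    rw [← natDegree_pos_iff_degree_pos]
    exact le_natDegree_of_ne_zero (by simp [h1])
  have hCinj : Function.Injective (PowerSeries.C : L →+* PowerSeries L) := RingHom.injective _
  let Q : (PowerSeries L)[X] := P.map PowerSeries.C - C (1 + S)
  have hQlc : Q.leadingCoeff = PowerSeries.C P.leadingCoeff := by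
    rw [leadingCoeff_sub_of_degree_lt, leadingCoeff_map_of_injective hCinj]
    rw [degree_map_eq_of_injective hCinj]
    exact degree_C_le.trans_lt hdeg
  -- Hensel's lemma is applied to a monic polynomial, hence the division by the leading coefficient;
  -- subtracting 1 + S does not change it, as P is not constant.
  have hmonic : (C (PowerSeries.C P.leadingCoeff⁻¹) * Q).Monic := by
    refine monic_C_mul_of_mul_leadingCoeff_eq_one ?_
    rw [hQlc, ← map_mul, inv_mul_cancel₀ hlc, map_one]
  have hev (t : PowerSeries L) : (C (PowerSeries.C P.leadingCoeff⁻¹) * Q).eval t =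
      PowerSeries.C P.leadingCoeff⁻¹ * (P.eval₂ PowerSeries.C t - (1 + S)) := by
    simp [Q, eval_map]
  obtain ⟨t, ht, ht0⟩ := HenselianRing.is_henselian (I := Ideal.span {PowerSeries.X}) _ hmonic 0
    (by
      rw [hev, eval₂_at_zero, h0, map_one, Ideal.mem_span_singleton, PowerSeries.X_dvd_iff]
      simp [hS])
    (by
      refine IsUnit.map _ ?_
      rw [← coeff_zero_eq_eval_zero, coeff_derivative, coeff_C_mul]
      simp [Q, coeff_map, h1, coeff_one, hlc])
  refine ⟨t, ?_, ?_⟩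
  · rwa [sub_zero, Ideal.mem_span_singleton, PowerSeries.X_dvd_iff] at ht0
  · rw [IsRoot, hev] at ht
    refine sub_eq_zero.1 ((mul_eq_zero.1 ht).resolve_left ?_)
    simpa using hlc

end PowerSeries

variable {K : Type*} [Field K] {θ : RingAut K}

/-! ### Trace and norm polynomial -/

section Norm

/-- Dedekind's independence of characters makes the trace nonzero even if the characteristic divides
r. A nonzero trace is fixed by `θ`, so dividing by it normalizes the value to 1. -/
theorem exists_sum_pow_eq_one (hθ : IsOfFinOrder θ) :
    ∃ e : K, ∑ i ∈ Finset.range (orderOf θ), (θ ^ i) e = 1 := by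
  have hinj : Function.Injective fun i : Fin (orderOf θ) => ((θ ^ (i : ℕ) : RingAut K) : K →* K) := by
    intro i k h
    have h2 : θ ^ (i : ℕ) = θ ^ (k : ℕ) := RingEquiv.ext fun a => DFunLike.congr_fun h a
    exact Fin.ext (pow_injOn_Iio_orderOf i.2 k.2 h2)
  have hli := (linearIndependent_monoidHom K K).comp _ hinj
  obtain ⟨a, ha⟩ : ∃ a : K, ∑ i ∈ Finset.range (orderOf θ), (θ ^ i) a ≠ 0 := by
    by_contra! h
    have h2 := Fintype.linearIndependent_iff.1 hli (fun _ => 1) (by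
      ext a
      refine Eq.trans ?_ (h a)
      rw [Finset.sum_range]
      simp)
    exact one_ne_zero (h2 ⟨0, hθ.orderOf_pos⟩)
  set c := ∑ i ∈ Finset.range (orderOf θ), (θ ^ i) a with hc
  have hθc : θ c = c := by
    rw [hc, map_sum]
    have h1 := Finset.sum_range_succ (fun i => (θ ^ i) a) (orderOf θ)
    rw [Finset.sum_range_succ', pow_orderOf_eq_one, pow_zero, add_left_inj] at h1
    rw [← h1]
    refine Finset.sum_congr rfl fun i _ => ?_
    rw [pow_succ', RingAut.mul_apply]
  have hpow (i : ℕ) : (θ ^ i) c⁻¹ = c⁻¹ := by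
    have := SkewLaurent.fixed_zpow θ ⟨c, hθc⟩ i
    rw [zpow_natCast] at this
    rw [map_inv₀, this]
  refine ⟨c⁻¹ * a, ?_⟩
  simp only [map_mul, hpow, ← Finset.mul_sum]
  exact inv_mul_cancel₀ ha

/-- The polynomial `∏ (1 + θ^i(e) X)`, the product being over `i < n`. -/
def normPoly (θ : RingAut K) (e : K) (n : ℕ) : K[X] :=
  ∏ i ∈ Finset.range n, (1 + C ((θ ^ i) e) * X)

theorem normPoly_succ (e : K) (n : ℕ) :
    normPoly θ e (n + 1) = normPoly θ e n * (1 + C ((θ ^ n) e) * X) :=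
  Finset.prod_range_succ _ _

theorem coeff_zero_normPoly (e : K) (n : ℕ) : (normPoly θ e n).coeff 0 = 1 := by
  induction n with
  | zero => simp [normPoly]
  | succ n ih => rw [normPoly_succ, mul_coeff_zero, ih]; simp

theorem coeff_one_normPoly (e : K) (n : ℕ) :
    (normPoly θ e n).coeff 1 = ∑ i ∈ Finset.range n, (θ ^ i) e := by
  induction n with
  | zero => simp [normPoly, coeff_one]
  | succ n ih =>
    rw [normPoly_succ, Finset.sum_range_succ, ← ih, mul_coeff_one, coeff_zero_normPoly]
    simp [coeff_one, add_comm]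

/-- Since θ^r = 1, applying `θ` to the coefficients permutes the factors cyclically, so every
coefficient is fixed. -/
theorem exists_map_eq_normPoly (e : K) :
    ∃ P : (FixedField θ)[X], P.map (FixedField θ).subtype = normPoly θ e (orderOf θ) := by
  rw [← mem_lifts, lifts_iff_coeff_lifts]
  have h : (normPoly θ e (orderOf θ)).map (θ : K →+* K) = normPoly θ e (orderOf θ) := by
    have h1 := Finset.prod_range_succ (fun i => (1 + C ((θ ^ i) e) * X : K[X])) (orderOf θ)
    rw [Finset.prod_range_succ', pow_orderOf_eq_one, pow_zero] at h1
    -- The product over 0, ..., r is split at either end; cancelling the common factor 1 + eX gives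
    -- the invariance.
    have hne : (1 + C ((1 : RingAut K) e) * X : K[X]) ≠ 0 := fun h0 => by
      simpa using congrArg (fun p => coeff p 0) h0
    rw [normPoly, Polynomial.map_prod, ← mul_right_cancel₀ hne h1]
    refine Finset.prod_congr rfl fun i _ => ?_
    simp [pow_succ', RingAut.mul_apply]
  intro n
  refine ⟨⟨(normPoly θ e (orderOf θ)).coeff n, ?_⟩, rfl⟩
  exact (coeff_map (θ : K →+* K) n).symm.trans (congrArg (fun p => coeff p n) h)

end Norm

/-! ### Morphisms out of 𝒜 and out of its completion -/

/-- The universal property of the ring of skew Laurent polynomials. -/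
theorem SkewLaurent.exists_ringHom {B : Type*} [Ring B] (φ : K →+* B) (x : Bˣ)
    (hx : ∀ a, (x : B) * φ a = φ (θ a) * x) :
    ∃ Ψ : SkewLaurent θ →+* B, (∀ a, Ψ (C θ a) = φ a) ∧ Ψ (X θ) = x := by
  have hinv (a : K) : ((x⁻¹ : Bˣ) : B) * φ a = φ (θ⁻¹ a) * ((x⁻¹ : Bˣ) : B) := by
    rw [Units.inv_mul_eq_iff_eq_mul, ← mul_assoc, hx, mul_assoc, Units.mul_inv, mul_one,
      ← RingAut.mul_apply, mul_inv_cancel]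
    rfl
  have hz (n : ℤ) : ∀ a, ((x ^ n : Bˣ) : B) * φ a = φ ((θ ^ n) a) * ((x ^ n : Bˣ) : B) := by
    induction n using Int.induction_on with
    | zero => simp
    | succ n ih =>
      intro a
      rw [zpow_add_one, zpow_add_one, Units.val_mul, mul_assoc, hx, ← mul_assoc, ih, mul_assoc,
        RingAut.mul_apply]
    | pred n ih =>
      intro a
      rw [zpow_sub_one, zpow_sub_one, Units.val_mul, mul_assoc, hinv, ← mul_assoc, ih, mul_assoc,
        RingAut.mul_apply]
  let _ := zAction θ
  let Ψ : SkewLaurent θ →+* B := SkewMonoidAlgebra.liftNCRingHom φ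
    ((Units.coeHom B).comp (zpowersHom Bˣ x)) (by
      intro a n
      exact (hz n.toAdd a).symm)
  have hΨ (n : ℤ) (a : K) : Ψ (monomial θ n a) = φ a * ((x ^ n : Bˣ) : B) :=
    SkewMonoidAlgebra.liftNC_single _ _ _ _
  refine ⟨Ψ, fun a => ?_, ?_⟩
  · exact (hΨ 0 a).trans (by simp)
  · exact (hΨ 1 1).trans (by simp)

/-- N is sent to a multiple of T and T is central, so elements of N^m𝒜 are sent to multiples of T^m.
The coefficient of T^n thus depends only on the class modulo N^(n+1). -/
theorem exists_completion_ringHom {B : Type*} [Ring B] (Ψ : SkewLaurent θ →+* PowerSeries B)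
    (N : (FixedField θ)[X])
    (hN : PowerSeries.constantCoeff (Ψ (SkewLaurent.ofCentral θ N)) = 0) :
    ∃ τ : completion θ N →+* PowerSeries B, ∀ g, τ (toCompletion θ N g) = Ψ g := by
  have hker {m : ℕ} {g : SkewLaurent θ} (hg : g ∈ centralIdeal θ (N ^ m)) {n : ℕ} (hn : n < m) :
      PowerSeries.coeff n (Ψ g) = 0 := by
    obtain ⟨c, rfl⟩ := Ideal.mem_span_singleton'.1 hg
    obtain ⟨E, hE⟩ := PowerSeries.X_dvd_iff.2 hN
    refine PowerSeries.X_pow_dvd_iff.1 ⟨Ψ c * E ^ m, ?_⟩ n hn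
    rw [map_mul, map_pow, map_pow, hE, (PowerSeries.commute_X E).symm.mul_pow, ← mul_assoc,
      ← mul_assoc, PowerSeries.X_pow_mul]
  choose ℓ hℓ using fun (f : completion θ N) (m : ℕ) =>
    Ideal.Quotient.mk_surjective (I := centralIdeal θ (N ^ m)) (f.1 m)
  let t (f : completion θ N) : PowerSeries B :=
    PowerSeries.mk fun n => PowerSeries.coeff n (Ψ (ℓ f (n + 1)))
  -- Any representative at any level m > n computes the n-th coefficient; additivity and
  -- multiplicativity follow by picking convenient ones.
  have ht {f : completion θ N} {m n : ℕ} {g : SkewLaurent θ} (hn : n < m)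
      (hg : Ideal.Quotient.mk _ g = f.1 m) :
      PowerSeries.coeff n (t f) = PowerSeries.coeff n (Ψ g) := by
    rw [PowerSeries.coeff_mk, ← sub_eq_zero, ← map_sub, ← map_sub]
    refine hker ?_ (Nat.lt_succ_self n)
    rw [← Ideal.Quotient.eq, hℓ, ← f.2 (n + 1) m hn, ← hg]
    rfl
  have ht' (f : completion θ N) {m n : ℕ} (hn : n < m) :
      PowerSeries.coeff n (t f) = PowerSeries.coeff n (Ψ (ℓ f m)) := ht hn (hℓ f m)
  have htc (g : SkewLaurent θ) : t (toCompletion θ N g) = Ψ g :=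
    PowerSeries.ext fun n => ht (Nat.lt_succ_self n) rfl
  refine ⟨{ toFun := t
            map_one' := ?_
            map_zero' := ?_
            map_add' := fun f g => ?_
            map_mul' := fun f g => ?_ }, htc⟩
  · rw [← map_one (toCompletion θ N), htc, map_one]
  · ext n
    rw [PowerSeries.coeff_mul]
    have h : Ideal.Quotient.mk _ (ℓ f (n + 1) * ℓ g (n + 1)) = (f * g).1 (n + 1) := by
      rw [map_mul, hℓ, hℓ]
      rfl
    rw [ht (Nat.lt_succ_self n) h, map_mul, PowerSeries.coeff_mul]
    refine Finset.sum_congr rfl fun p hp => ?_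
    have := Finset.HasAntidiagonal.mem_antidiagonal.1 hp
    rw [ht' f (m := n + 1) (by omega), ht' g (m := n + 1) (by omega)]
  · rw [← map_zero (toCompletion θ N), htc, map_zero]
  · ext n
    have h : Ideal.Quotient.mk _ (ℓ f (n + 1) + ℓ g (n + 1)) = (f + g).1 (n + 1) := by
      rw [map_add, hℓ, hℓ]
      rfl
    rw [ht (Nat.lt_succ_self n) h, map_add, map_add, map_add, ht' f (Nat.lt_succ_self n),
      ht' g (Nat.lt_succ_self n)]

/-! ### Existence of admissible morphisms -/

section Existence

variable (θ) in
/-- The map `F[Y] / N → 𝒜 / N𝒜`. -/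
def centerQuot (N : (FixedField θ)[X]) : AdjoinRoot N →+* SkewQuot θ N :=
  Ideal.Quotient.lift (Ideal.span {N})
    ((Ideal.Quotient.mk (centralIdeal θ N)).comp (SkewLaurent.ofCentral θ)) (by
      intro a ha
      obtain ⟨c, rfl⟩ := Ideal.mem_span_singleton'.1 ha
      rw [RingHom.comp_apply, map_mul, Ideal.Quotient.eq_zero_iff_mem]
      exact Ideal.mul_mem_left _ _ (Ideal.mem_span_singleton_self _))

theorem centerQuot_mk (N p : (FixedField θ)[X]) : centerQuot θ N (AdjoinRoot.mk N p) =
    Ideal.Quotient.mk (centralIdeal θ N) (SkewLaurent.ofCentral θ p) := rfl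

theorem centerQuot_commute (N : (FixedField θ)[X]) (l : AdjoinRoot N) (b : SkewQuot θ N) :
    Commute (centerQuot θ N l) b := by
  obtain ⟨p, rfl⟩ := AdjoinRoot.mk_surjective l
  obtain ⟨b, rfl⟩ := Ideal.Quotient.mk_surjective b
  exact (SkewLaurent.ofCentral_comm θ p b).map (Ideal.Quotient.mk (centralIdeal θ N))

theorem map_centerQuot_commute_C (N : (FixedField θ)[X]) (t : PowerSeries (AdjoinRoot N))
    (b : SkewQuot θ N) : Commute (PowerSeries.map (centerQuot θ N) t) (PowerSeries.C b) := by
  ext n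
  rw [PowerSeries.coeff_mul_C, PowerSeries.coeff_C_mul, PowerSeries.coeff_map]
  exact centerQuot_commute N _ b

theorem mk_X_mul_mk_C (N : (FixedField θ)[X]) (a : K) :
    Ideal.Quotient.mk (centralIdeal θ N) (SkewLaurent.X θ) *
      Ideal.Quotient.mk (centralIdeal θ N) (SkewLaurent.C θ a) =
    Ideal.Quotient.mk (centralIdeal θ N) (SkewLaurent.C θ (θ a)) *
      Ideal.Quotient.mk (centralIdeal θ N) (SkewLaurent.X θ) := by
  rw [← map_mul, ← map_mul]
  congr 1
  change SkewLaurent.monomial θ 1 1 * SkewLaurent.monomial θ 0 a =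
    SkewLaurent.monomial θ 0 (θ a) * SkewLaurent.monomial θ 1 1
  simp [SkewLaurent.monomial_mul_monomial]

/-- An `r`-th root of `z + T` in `(𝒜 / N𝒜)[[T]]` that satisfies the commutation rules of `X`. -/
theorem exists_root_add_X (hθ : IsOfFinOrder θ) (N : (FixedField θ)[X]) [Fact (Irreducible N)]
    (hN : AdjoinRoot.root N ≠ 0) :
    ∃ x : (PowerSeries (SkewQuot θ N))ˣ,
      PowerSeries.constantCoeff (x : PowerSeries (SkewQuot θ N)) =
        Ideal.Quotient.mk _ (SkewLaurent.X θ) ∧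
      (x : PowerSeries (SkewQuot θ N)) ^ orderOf θ =
        PowerSeries.C (Ideal.Quotient.mk _ (SkewLaurent.Y θ)) + PowerSeries.X ∧
      ∀ a : K, (x : PowerSeries (SkewQuot θ N)) *
          PowerSeries.C (Ideal.Quotient.mk _ (SkewLaurent.C θ a)) =
        PowerSeries.C (Ideal.Quotient.mk _ (SkewLaurent.C θ (θ a))) *
          (x : PowerSeries (SkewQuot θ N)) := by
  obtain ⟨e, he⟩ := exists_sum_pow_eq_one hθ
  obtain ⟨P, hP⟩ := exists_map_eq_normPoly (θ := θ) e
  have hP0 : P.coeff 0 = 1 := by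
    apply (FixedField θ).subtype.injective
    rw [← coeff_map, hP, coeff_zero_normPoly, map_one]
  have hP1 : P.coeff 1 = 1 := by
    apply (FixedField θ).subtype.injective
    rw [← coeff_map, hP, coeff_one_normPoly, he, map_one]
  -- Solve P(t) = 1 + T/z over the field F[Y]/N; this is where z ≠ 0 and the trace of `e` being 1
  -- enter.
  obtain ⟨t, ht0, ht⟩ := exists_eval₂_eq_one_add (P := P.map (AdjoinRoot.of N))
    (by rw [coeff_map, hP0, map_one]) (by rw [coeff_map, hP1, map_one])
    (S := PowerSeries.X * PowerSeries.C (AdjoinRoot.root N)⁻¹) (by simp)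
  let κ : K →+* PowerSeries (SkewQuot θ N) :=
    PowerSeries.C.comp ((Ideal.Quotient.mk (centralIdeal θ N)).comp (SkewLaurent.C θ))
  let u : PowerSeries (SkewQuot θ N) := PowerSeries.map (centerQuot θ N) t
  let Φ : K[X] →+* PowerSeries (SkewQuot θ N) :=
    eval₂RingHom' κ u fun a => (map_centerQuot_commute_C N t _).symm
  have hΦC (a : K) : Φ (C a) = κ a := eval₂_C _ _
  have hΦX : Φ X = u := eval₂_X _ _
  let ξ : PowerSeries (SkewQuot θ N) := PowerSeries.C (Ideal.Quotient.mk _ (SkewLaurent.X θ))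
  have hξκ (a : K) : ξ * κ a = κ (θ a) * ξ := by
    change PowerSeries.C _ * PowerSeries.C _ = PowerSeries.C _ * PowerSeries.C _
    rw [← map_mul, ← map_mul]
    exact congrArg _ (mk_X_mul_mk_C N a)
  have hξκ' (n : ℕ) : ∀ a : K, ξ ^ n * κ a = κ ((θ ^ n) a) * ξ ^ n := by
    induction n with
    | zero => simp
    | succ n ih =>
      intro a
      rw [pow_succ, mul_assoc, hξκ, ← mul_assoc, ih, mul_assoc, pow_succ, RingAut.mul_apply]
  have hξu : Commute ξ u := (map_centerQuot_commute_C N t _).symm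
  have hξΦ (n : ℕ) (a : K) : ξ ^ n * Φ (1 + C a * X) = Φ (1 + C ((θ ^ n) a) * X) * ξ ^ n := by
    simp only [map_add, map_mul, map_one, hΦC, hΦX, mul_add, add_mul, mul_one, one_mul]
    rw [← mul_assoc, hξκ', mul_assoc, (hξu.pow_left n).eq, mul_assoc]
  have hκΦ (a : K) (p : K[X]) : Commute (κ a) (Φ p) := by
    rw [← hΦC]
    exact (Commute.all (C a) p).map Φ
  -- Moving ξ^n to the right past 1 + eu applies θ^n to `e`, so the powers build up the norm
  -- polynomial.
  have hpow (n : ℕ) : (Φ (1 + C e * X) * ξ) ^ n = Φ (normPoly θ e n) * ξ ^ n := by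
    induction n with
    | zero => simp [normPoly]
    | succ n ih =>
      rw [pow_succ, ih, normPoly_succ, map_mul, mul_assoc, ← mul_assoc (ξ ^ n), hξΦ, pow_succ]
      simp only [mul_assoc]
  have hΦP : Φ (normPoly θ e (orderOf θ)) = PowerSeries.map (centerQuot θ N)
      (1 + PowerSeries.X * PowerSeries.C (AdjoinRoot.root N)⁻¹) := by
    rw [← ht, ← hP, eval₂_map]
    have hhom : Φ.comp (mapRingHom (FixedField θ).subtype) =
        (PowerSeries.map (centerQuot θ N)).comp
          (eval₂RingHom (PowerSeries.C.comp (AdjoinRoot.of N)) t) := by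
      refine Polynomial.ringHom_ext (fun a => ?_) ?_
      · simp only [RingHom.comp_apply, coe_mapRingHom, map_C, hΦC, coe_eval₂RingHom, eval₂_C,
          PowerSeries.map_C]
        change PowerSeries.C (Ideal.Quotient.mk _ (SkewLaurent.C θ a)) = _
        rw [← SkewLaurent.ofCentral_C, ← centerQuot_mk]
        rfl
      · simp only [RingHom.comp_apply, coe_mapRingHom, map_X, hΦX, coe_eval₂RingHom, eval₂_X]
        rfl
    exact RingHom.congr_fun hhom P
  have hY : ξ ^ orderOf θ = PowerSeries.map (centerQuot θ N)
      (PowerSeries.C (AdjoinRoot.root N)) := by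
    rw [PowerSeries.map_C, ← map_pow, ← map_pow, ← SkewLaurent.Y, ← SkewLaurent.ofCentral_X,
      ← centerQuot_mk]
    rfl
  -- (1 + T/z)·z = z + T.
  have hr : (Φ (1 + C e * X) * ξ) ^ orderOf θ = PowerSeries.map (centerQuot θ N)
      (PowerSeries.C (AdjoinRoot.root N) + PowerSeries.X) := by
    rw [hpow, hΦP, hY, ← map_mul, add_mul, one_mul, mul_assoc, ← map_mul, inv_mul_cancel₀ hN,
      map_one, mul_one]
  -- The r-th power z + T is a unit, as its constant term is nonzero in a field.
  have hunit : IsUnit (Φ (1 + C e * X) * ξ) := by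
    refine (isUnit_pow_iff hθ.orderOf_pos.ne').1 ?_
    rw [hr]
    refine IsUnit.map _ (PowerSeries.isUnit_iff_constantCoeff.2 ?_)
    simpa using hN
  refine ⟨hunit.unit, ?_, ?_, fun a => ?_⟩
  · rw [IsUnit.unit_spec, map_mul]
    have hu0 : PowerSeries.constantCoeff u = 0 := by
      change PowerSeries.constantCoeff (PowerSeries.map (centerQuot θ N) t) = 0
      rw [← PowerSeries.coeff_zero_eq_constantCoeff_apply, PowerSeries.coeff_map,
        PowerSeries.coeff_zero_eq_constantCoeff_apply, ht0, map_zero]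
    simp [hΦX, hu0, ξ]
  · rw [IsUnit.unit_spec, hr, map_add, PowerSeries.map_X, ← hY, ← map_pow, ← map_pow]
    rfl
  · rw [IsUnit.unit_spec]
    change _ * κ a = κ (θ a) * _
    rw [mul_assoc, hξκ, ← mul_assoc, ← mul_assoc, (hκΦ _ _).eq]

theorem nonempty_admissible (hθ : IsOfFinOrder θ) {Fs : Type*} [Field Fs]
    [Algebra (FixedField θ) Fs] {z : Fs} (hint : IsIntegral (FixedField θ) z) (hz : z ≠ 0) :
    Nonempty (Admissible θ z) := by
  have : Fact (Irreducible (minpoly (FixedField θ) z)) := ⟨minpoly.irreducible hint⟩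
  have hroot : AdjoinRoot.root (minpoly (FixedField θ) z) ≠ 0 := by
    intro h
    rw [← AdjoinRoot.mk_X, AdjoinRoot.mk_eq_zero] at h
    obtain ⟨q, hq⟩ := h
    apply hz
    rw [← aeval_X (R := FixedField θ) z, hq, map_mul, minpoly.aeval, zero_mul]
  obtain ⟨x, hx0, hxr, hxC⟩ := exists_root_add_X hθ (minpoly (FixedField θ) z) hroot
  obtain ⟨Ψ, hΨC, hΨX⟩ := SkewLaurent.exists_ringHom (θ := θ) (PowerSeries.C.comp
    ((Ideal.Quotient.mk (centralIdeal θ (minpoly (FixedField θ) z))).comp (SkewLaurent.C θ))) x hxC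
  -- Modulo T the morphism is reduction modulo N, so N has zero constant term and `Ψ` extends to the
  -- completion.
  have hmod : PowerSeries.constantCoeff.comp Ψ =
      Ideal.Quotient.mk (centralIdeal θ (minpoly (FixedField θ) z)) := by
    refine SkewLaurent.ringHom_ext (fun a => ?_) ?_
    · rw [RingHom.comp_apply, hΨC]
      simp
    · rw [RingHom.comp_apply, hΨX, hx0]
  obtain ⟨τ, hτ⟩ := exists_completion_ringHom Ψ (minpoly (FixedField θ) z) (by
    rw [← RingHom.comp_apply, hmod]
    exact mk_ofCentral_eq_zero (minpoly.aeval _ _))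
  exact ⟨{
    toRingHom := τ
    map_C := fun a => by rw [hτ, hΨC]; rfl
    map_X := by rw [hτ, hΨX, hx0]
    map_Y := by rw [hτ, SkewLaurent.Y, map_pow, hΨX, hxr, SkewLaurent.Y] }⟩

end Existence

/-! ### Conclusion -/

open Classical in
/-- The residue formula, with respect to any choice of admissible morphisms. -/
theorem finite_support_and_finsum_partialRes_eq_zero (hθ : IsOfFinOrder θ) {Fs : Type*} [Field Fs]
    [Algebra (FixedField θ) Fs] [IsSepClosure (FixedField θ) Fs]
    (τ : ∀ z : Fs, z ≠ 0 → Admissible θ z) {f : SkewFrac θ} (hf : PolesSeparable Fs f)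
    (h : ∀ (z : Fs) (hz : z ≠ 0), ((-1 : ℤ) : WithTop ℤ) ≤ (τ z hz).ord f) (j : ℕ) :
    (Function.support (partialRes hθ τ j f)).Finite ∧
      ∑ᶠ p : OnePoint Fs, partialRes hθ τ j f p = 0 := by
  obtain ⟨g, D, rfl, hs, hroots⟩ := hf.exists_simple_roots Fs τ h
  set P := (D : (FixedField θ)[X]).map (algebraMap (FixedField θ) Fs) with hPdef
  have hP : P ≠ 0 := (Polynomial.map_ne_zero_iff (algebraMap (FixedField θ) Fs).injective).2
    (nonZeroDivisors.coe_ne_zero D)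
  have hmem (z : Fs) : z ∈ P.roots.toFinset ↔ aeval z (D : (FixedField θ)[X]) = 0 := by
    rw [Multiset.mem_toFinset, mem_roots hP, IsRoot, hPdef, eval_map_algebraMap]
  have h0 : (0 : Fs) ∉ P.roots.toFinset := fun h0 => (hroots 0 ((hmem 0).1 h0)).1 rfl
  -- Only 0, ∞ and the roots of `D` can carry a residue.
  let s : Finset (OnePoint Fs) :=
    insert OnePoint.infty ((insert 0 P.roots.toFinset).map ⟨_, OnePoint.coe_injective⟩)
  have hsub : Function.support (partialRes hθ τ j (LocalizedModule.mk g D)) ⊆ s := by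
    intro p hp
    induction p using OnePoint.rec with
    | infty => simp [s]
    | coe z =>
      by_contra hz
      have hz2 : z ≠ 0 ∧ z ∉ P.roots.toFinset := by
        rw [← not_or]
        intro hz'
        refine hz (Finset.mem_insert_of_mem (Finset.mem_map.2 ⟨z, ?_, rfl⟩))
        exact Finset.mem_insert.2 hz'
      refine hp ((dif_neg hz2.1).trans ?_)
      exact (τ z hz2.1).partialRes_eq_zero hθ hz2.1 j g D (h z hz2.1)
        fun hz3 => hz2.2 ((hmem z).2 hz3)
  refine ⟨s.finite_toSet.subset hsub, ?_⟩
  rw [finsum_eq_sum_of_support_subset _ hsub, Finset.sum_insert (by simp), Finset.sum_map,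
    Finset.sum_insert h0,
    ← sum_roots_add_partialResZero_add_partialResInfty hθ j g D hs hroots, add_comm]
  refine congrArg₂ _ ?_ rfl
  rw [add_comm]
  refine congrArg₂ _ (Finset.sum_congr rfl fun z hz => ?_) ?_
  · have hz0 := (hroots z ((hmem z).1 hz)).1
    rw [dif_pos hz0, ← (τ z hz0).partialRes_eq_of_root hθ hz0 j g D (h z hz0) ((hmem z).1 hz)
      (hroots z ((hmem z).1 hz)).2]
    exact dif_neg hz0
  · exact dif_pos rfl

end SkewResidue

end

open SkewResidue in
theorem mainTheorem1 {K : Type*} [Field K] (θ : RingAut K) (hθ : IsOfFinOrder θ)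
    (Fs : Type*) [Field Fs] [Algebra (FixedField θ) Fs] [IsSepClosure (FixedField θ) Fs] :
    (∀ z : Fs, z ≠ 0 → Nonempty (Admissible θ z)) ∧
    ∀ (τ : ∀ z : Fs, z ≠ 0 → Admissible θ z) (f : SkewFrac θ),
      PolesSeparable Fs f →
      (∀ (z : Fs) (hz : z ≠ 0), ((-1 : ℤ) : WithTop ℤ) ≤ (τ z hz).ord f) →
      ∀ j : ℕ, j < orderOf θ →
        (Function.support (partialRes hθ τ j f)).Finite ∧
        ∑ᶠ p : OnePoint Fs, partialRes hθ τ j f p = 0 := by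
  exact ⟨fun _ hz => nonempty_admissible hθ (Admissible.isIntegral_of_isSepClosure _) hz,
    fun τ _ hf h j _ => finite_support_and_finsum_partialRes_eq_zero hθ τ hf h j⟩
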